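/- Let $\Lambda_{\mathbb Q}=\mathbb Q[p_1,p_2,\dots]$ be the ring of symmetric functions over $\mathbb Q$ in the variables $x=(x_1,x_2,\dots)$, where $p_k=\sum_i x_i^k$, and let $\omega$ be its standard involution, the algebra homomorphism with $\omega(p_k)=(-1)^{k-1}p_k$. For $f\in\Lambda_{\mathbb Q}$ put $f(x/y)=\omega_y f(x,y)$, where $y=(y_1,y_2,\dots)$ is a second set of variables and $\omega_y$ is $\omega$ acting on the $y$ variables only, and let $f(x/x)$ be obtained from $f(x/y)$ by setting $y=x$; equivalently, $f(x/x)$ arises from $f$, written as a polynomial in the $p_k$, by $p_k\mapsto 2p_k$ for odd $k$ and $p_k\mapsto 0$ for even $k$. A parking function of length $n$ is a sequence $(a_1,\dots,a_n)$ of positive integers whose increasing rearrangement $b_1\le\cdots\le b_n$ satisfies $b_i\le i$ for all $i$. The symmetric group $\mathfrak S_n$ acts on the set of parking functions of length $n$ by permuting coordinates. Let $\mathrm{PF}_n=\frac1{n!}\sum_{w\in\mathfrak S_n}\chi(w)\,p_{\rho(w)}$ be the Frobenius characteristic of this action, where $\chi$ is the character of the permutation representation, $\rho(w)$ is the cycle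 type of $w$ and $p_\mu=p_{\mu_1}p_{\mu_2}\cdots$. Put $\mathrm{SH}_n(x)=\mathrm{PF}_n(x/x)$. For a partition $\lambda$ with distinct parts let $\ell(\lambda)$ be its number of parts and let $P_\lambda$ be Schur's $P$-function, $P_\lambda(x)=\sum_T x^T$. Here $T$ ranges over the fillings of the shifted diagram of $\lambda$ with letters from $1'<1<2'<2<\cdots$ that increase weakly along rows and down columns, have each $k'$ at most once in every row and each $k$ at most once in every column, and have no marked letter $k'$ on the main diagonal; $x^T$ is the product, over all cells, of $x_k$ where the entry is $k$ or $k'$. For a symmetric function $f$ let $f(1^{m})$ be its value at $x_1=\cdots=x_m=1$, $x_i=0$ for $i>m$. Then for every integer $n\ge 0$, $$ \mathrm{SH}_n(x)=\frac{1}{n+1}\sum_{\lambda} 2^{\ell(\lambda)}\,P_\lambda(1^{n+1})\,P_\lambda(x), $$ where $\lambda$ ranges over all partitions of $n$ into distinct parts. -/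

import Mathlib

open scoped TensorProduct

noncomputable section

/-! ### Symmetric functions over `ℚ` in the variables `x 0, x 1, x 2, …` -/

namespace ShiftedParking

/-- Formal power series over `ℚ` in countably many variables. -/
abbrev Series : Type := MvPowerSeries ℕ ℚ

open Classical in
/-- The power sum `p_k = ∑ i, x_i ^ k` for `k ≥ 1`, given by its coefficients. -/
def powerSum (k : ℕ) : Series := fun d => if ∃ i, d = Finsupp.single i k then 1 else 0

/-- The ring `Λ_ℚ = ℚ[p₁, p₂, …]` of symmetric functions, as a ring of power series. -/
def Sym : Subalgebra ℚ Series := Algebra.adjoin ℚ (Set.range fun i : ℕ => powerSum (i + 1))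

theorem coeff_powerSum (k : ℕ) (d : ℕ →₀ ℕ) [Decidable (∃ i, d = Finsupp.single i k)] :
    MvPowerSeries.coeff d (powerSum k) = if ∃ i, d = Finsupp.single i k then 1 else 0 := by
  rw [MvPowerSeries.coeff_apply]
  unfold powerSum
  congr

theorem pderiv_powerSum (j k : ℕ) :
    MvPowerSeries.pderiv ℚ j (powerSum (k + 1)) =
      ((k : ℚ) + 1) • (MvPowerSeries.X j : Series) ^ k := by
  classical
  ext d
  rw [MvPowerSeries.coeff_pderiv, coeff_powerSum, MvPowerSeries.coeff_smul,
    MvPowerSeries.coeff_X_pow]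
  have key : (∃ i, d + Finsupp.single j 1 = Finsupp.single i (k + 1)) ↔ d = Finsupp.single j k := by
    constructor
    · rintro ⟨i, hi⟩
      have hij : j = i := by
        by_contra hne
        have := DFunLike.congr_fun hi j
        simp [Ne.symm hne] at this
      subst hij
      rw [Finsupp.single_add] at hi
      exact add_right_cancel hi
    · rintro rfl
      exact ⟨j, by rw [Finsupp.single_add]⟩
  by_cases h : d = Finsupp.single j k
  · rw [if_pos (key.2 h), if_pos h, h]
    simp
  · rw [if_neg (fun h' => h (key.1 h')), if_neg h]
    simp

theorem pderiv_aeval_powerSum (s : Finset ℕ) (j : ℕ) (F : MvPolynomial s ℚ) :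
    MvPowerSeries.pderiv ℚ j (MvPolynomial.aeval (fun i : s => powerSum (i + 1)) F) =
      ∑ i : s, MvPolynomial.aeval (fun i : s => powerSum (i + 1)) (MvPolynomial.pderiv i F) *
        MvPowerSeries.pderiv ℚ j (powerSum (i + 1)) := by
  classical
  induction F using MvPolynomial.induction_on with
  | C a => simp
  | add p q hp hq => simp only [map_add, hp, hq, add_mul, Finset.sum_add_distrib]
  | mul_X p k hp =>
    rw [map_mul, MvPolynomial.aeval_X, Derivation.leibniz, hp]
    simp only [MvPolynomial.pderiv_mul, map_add, map_mul, MvPolynomial.aeval_X, add_mul,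
      Finset.sum_add_distrib, smul_eq_mul, Finset.mul_sum, MvPolynomial.pderiv_X]
    rw [add_comm]
    congr 1
    · exact Finset.sum_congr rfl fun i _ => by ring
    · rw [Finset.sum_eq_single k]
      · simp
      · intro i _ hi
        simp [hi.symm]
      · simp

theorem aeval_pderiv_eq_zero (s : Finset ℕ) (F : MvPolynomial s ℚ)
    (hF : MvPolynomial.aeval (fun i : s => powerSum (i + 1)) F = 0) (i : s) :
    MvPolynomial.aeval (fun i : s => powerSum (i + 1)) (MvPolynomial.pderiv i F) = 0 := by
  classical
  let G : s → Series := fun i =>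
    (((i : ℕ) : ℚ) + 1) • MvPolynomial.aeval (fun i : s => powerSum (i + 1))
      (MvPolynomial.pderiv i F)
  let Q : Polynomial Series := ∑ i : s, Polynomial.monomial (i : ℕ) (G i)
  have : IsDomain Series := NoZeroDivisors.to_isDomain _
  have hQ : Q = 0 := by
    apply Polynomial.eq_zero_of_infinite_isRoot
    refine (Set.infinite_range_of_injective (f := fun j : ℕ => (MvPowerSeries.X j : Series))
      fun a b hab => MvPowerSeries.X_inj.1 hab).mono ?_
    rintro _ ⟨j, rfl⟩
    have h := pderiv_aeval_powerSum s j F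
    rw [hF, map_zero] at h
    simp only [Set.mem_ofPred_eq, Polynomial.IsRoot, Q, Polynomial.eval_finsetSum,
      Polynomial.eval_monomial, G]
    rw [h]
    refine Finset.sum_congr rfl fun i _ => ?_
    rw [pderiv_powerSum, smul_mul_assoc, mul_smul_comm]
  have hi := congrArg (fun q => Polynomial.coeff q (i : ℕ)) hQ
  simp only [Q, Polynomial.finsetSum_coeff, Polynomial.coeff_monomial, Polynomial.coeff_zero,
    Subtype.coe_inj, Finset.sum_ite_eq', Finset.mem_univ, if_true, G] at hi
  exact (smul_eq_zero.1 hi).resolve_left (by positivity)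

theorem coeff_eq_zero_of_aeval_powerSum (s : Finset ℕ) (k : ℕ) : ∀ F : MvPolynomial s ℚ,
    MvPolynomial.aeval (fun i : s => powerSum (i + 1)) F = 0 →
      ∀ d : s →₀ ℕ, d.degree = k → MvPolynomial.coeff d F = 0 := by
  classical
  induction k with
  | zero =>
    intro F hF d hd
    obtain rfl : d = 0 := (Finsupp.degree_eq_zero_iff d).1 hd
    have h := congrArg (MvPowerSeries.constantCoeff (σ := ℕ) (R := ℚ)) hF
    rw [map_zero, MvPolynomial.aeval_def, MvPolynomial.hom_eval₂] at h
    have h0 : (fun i : s => MvPowerSeries.constantCoeff (powerSum ((i : ℕ) + 1))) = 0 := by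
      funext i
      rw [← MvPowerSeries.coeff_zero_eq_constantCoeff_apply, coeff_powerSum, if_neg]
      · rfl
      · rintro ⟨j, hj⟩
        have := DFunLike.congr_fun hj j
        simp at this
    rw [h0, show (MvPowerSeries.constantCoeff (σ := ℕ) (R := ℚ)).comp (algebraMap ℚ Series) =
      RingHom.id ℚ from RingHom.ext_rat _ _] at h
    rw [MvPolynomial.eval₂_id] at h
    rw [← MvPolynomial.constantCoeff_eq, ← MvPolynomial.eval_zero]
    exact h
  | succ k ih =>
    intro F hF d hd
    have hne : d ≠ 0 := by rintro rfl; simp at hd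
    obtain ⟨i, hi⟩ := Finsupp.ne_iff.1 hne
    have hd' : d = (d - Finsupp.single i 1) + Finsupp.single i 1 := by
      rw [tsub_add_cancel_of_le]
      rw [Finsupp.single_le_iff]
      exact Nat.one_le_iff_ne_zero.2 hi
    generalize d - Finsupp.single i 1 = e at hd'
    subst hd'
    have h := ih _ (aeval_pderiv_eq_zero s F hF i) e (by simpa using hd)
    rw [MvPolynomial.coeff_pderiv] at h
    exact (mul_eq_zero.1 h).resolve_right (by positivity)

/-- The power sums `p₁, p₂, …` are algebraically independent. -/
theorem algebraicIndependent_powerSum :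
    AlgebraicIndependent ℚ (fun i : ℕ => powerSum (i + 1)) := by
  rw [algebraicIndependent_iff]
  intro F hF
  obtain ⟨s, q, rfl⟩ := MvPolynomial.exists_finset_rename F
  rw [MvPolynomial.aeval_rename] at hF
  have hq : q = 0 := by
    ext d
    exact coeff_eq_zero_of_aeval_powerSum s _ q hF d rfl
  rw [hq, map_zero]

/-- The identification of `Λ_ℚ` with the polynomial ring in the power sums. -/
def symEquiv : MvPolynomial ℕ ℚ ≃ₐ[ℚ] Sym := algebraicIndependent_powerSum.aevalEquiv

/-- The power sum `p_k`, `k ≥ 1`, as an element of `Λ_ℚ`. -/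
def symP (k : ℕ) : Sym := symEquiv (MvPolynomial.X (k - 1))

theorem coe_symP (k : ℕ) (hk : 1 ≤ k) : (symP k : Series) = powerSum k := by
  obtain ⟨k, rfl⟩ := Nat.exists_eq_add_of_le' hk
  exact (algebraicIndependent_powerSum.algebraMap_aevalEquiv _).trans
    (MvPolynomial.aeval_X _ _)

/-- The algebra homomorphism out of `Λ_ℚ` that sends `p_k` to `a k` for all `k ≥ 1`. -/
def symLift {A : Type*} [CommSemiring A] [Algebra ℚ A] (a : ℕ → A) : Sym →ₐ[ℚ] A :=
  (MvPolynomial.aeval fun i : ℕ => a (i + 1)).comp symEquiv.symm.toAlgHom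

theorem symLift_symP {A : Type*} [CommSemiring A] [Algebra ℚ A] (a : ℕ → A) (k : ℕ) (hk : 1 ≤ k) :
    symLift a (symP k) = a k := by
  obtain ⟨k, rfl⟩ := Nat.exists_eq_add_of_le' hk
  simp [symLift, symP]

/-- The involution `ω` on symmetric functions, `ω p_k = (-1)^(k-1) p_k`. -/
def omega : Sym →ₐ[ℚ] Sym := symLift fun k => (-1 : ℚ) ^ (k - 1) • symP k

/-- `f ↦ f(x, y)`, where `Λ_ℚ ⊗ Λ_ℚ` is the ring of functions symmetric in `x` and in `y`
separately; here `p_k(x, y) = p_k(x) + p_k(y)`. -/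
def twoAlphabets : Sym →ₐ[ℚ] Sym ⊗[ℚ] Sym := symLift fun k => symP k ⊗ₜ[ℚ] 1 + 1 ⊗ₜ[ℚ] symP k

/-- The superfication `f(x/y) = ω_y f(x, y)`. -/
def superfication : Sym →ₐ[ℚ] Sym ⊗[ℚ] Sym :=
  (Algebra.TensorProduct.map (AlgHom.id ℚ Sym) omega).comp twoAlphabets

/-- The shiftification `f(x/x)`: set `y = x` in the superfication. -/
def shiftification : Sym →ₐ[ℚ] Sym := (Algebra.TensorProduct.lmul' ℚ).comp superfication

/-! ### Parking functions -/

/-- `a` is a parking function of length `n`: the entries are positive and the increasing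
rearrangement `b₁ ≤ … ≤ bₙ` of `a` satisfies `bᵢ ≤ i`. -/
def IsParking {n : ℕ} (a : Fin n → ℕ) : Prop :=
  (∀ i, 1 ≤ a i) ∧ ∀ i : Fin n, (a ∘ Tuple.sort a) i ≤ (i : ℕ) + 1

/-- The set of parking functions of length `n`. -/
def ParkingFunction (n : ℕ) : Type := {a : Fin n → ℕ // IsParking a}

theorem IsParking.comp_perm {n : ℕ} {a : Fin n → ℕ} (ha : IsParking a)
    (s : Equiv.Perm (Fin n)) : IsParking (a ∘ s) :=
  ⟨fun i => ha.1 (s i), fun i => by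
    rw [Tuple.comp_perm_comp_sort_eq_comp_sort]; exact ha.2 i⟩

/-- The symmetric group permutes the coordinates of parking functions. -/
instance (n : ℕ) : MulAction (Equiv.Perm (Fin n)) (ParkingFunction n) where
  smul s a := ⟨a.1 ∘ ⇑s⁻¹, a.2.comp_perm s⁻¹⟩
  one_smul _ := rfl
  mul_smul s t a := Subtype.ext (by
    change a.1 ∘ ⇑(s * t)⁻¹ = (a.1 ∘ ⇑t⁻¹) ∘ ⇑s⁻¹
    rw [mul_inv_rev]; rfl)

/-- The power sum `p_μ = p_{μ₁} p_{μ₂} ⋯`. -/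
def symPPart {m : ℕ} (μ : m.Partition) : Sym := (μ.parts.map symP).prod

/-- The Frobenius characteristic `(1/n!) ∑ w, χ(w) p_{ρ(w)}` of a function `χ` on the symmetric
group, where `ρ(w)` is the cycle type of `w` (with the fixed points as parts `1`). -/
def frobeniusCh {n : ℕ} (χ : Equiv.Perm (Fin n) → ℚ) : Sym :=
  ((n.factorial : ℚ)⁻¹) • ∑ w : Equiv.Perm (Fin n), χ w • symPPart w.partition

/-- The parking function symmetric function: the Frobenius characteristic of the permutation
representation of the symmetric group on parking functions. -/
def parkingSym (n : ℕ) : Sym :=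
  frobeniusCh (Representation.ofMulAction ℚ (Equiv.Perm (Fin n)) (ParkingFunction n)).character

/-- The shifted parking function symmetric function `PF_n(x/x)`. -/
def shiftedParkingSym (n : ℕ) : Sym := shiftification (parkingSym n)

/-! ### Schur P-functions -/

/-- The part `λ_{i+1}` of a partition written in decreasing order, `0` beyond the length. -/
def rowLen {n : ℕ} (lam : n.Partition) (i : ℕ) : ℕ := (lam.parts.sort (· ≥ ·)).getD i 0

/-- The shifted diagram of a partition with distinct parts: row `i` is moved `i` steps to the
right, so that it occupies the columns `i, …, i + λ_{i+1} - 1`. -/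
def shiftedDiagram {n : ℕ} (lam : n.Partition) : Finset (ℕ × ℕ) :=
  (Finset.range lam.parts.card).biUnion fun i => {i} ×ˢ Finset.Ico i (i + rowLen lam i)

/-- The alphabet `0' < 0 < 1' < 1 < 2' < 2 < ⋯`: the letter `(k, false)` is the marked letter `k'`
and `(k, true)` is the unmarked letter `k`. -/
abbrev Letter : Type := ℕ ×ₗ Bool

/-- The absolute value `k` of the letters `k'` and `k`. -/
def Letter.abs (a : Letter) : ℕ := (ofLex a).1

/-- Whether a letter is marked. -/
def Letter.Marked (a : Letter) : Prop := (ofLex a).2 = false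

/-- Marked shifted tableaux of a given shape with no marked letters on the main diagonal. -/
structure MarkedShiftedTableau {n : ℕ} (lam : n.Partition) where
  /-- the entries -/
  entry : shiftedDiagram lam → Letter
  row_le : ∀ c d, c.1.1 = d.1.1 → c.1.2 ≤ d.1.2 → entry c ≤ entry d
  col_le : ∀ c d, c.1.2 = d.1.2 → c.1.1 ≤ d.1.1 → entry c ≤ entry d
  /-- each row contains each marked letter at most once -/
  row_marked : ∀ c d, c.1.1 = d.1.1 → c.1.2 < d.1.2 → entry c = entry d → ¬ (entry c).Marked
  /-- each column contains each unmarked letter at most once -/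
  col_unmarked : ∀ c d, c.1.2 = d.1.2 → c.1.1 < d.1.1 → entry c = entry d → (entry c).Marked
  diag_unmarked : ∀ c, c.1.1 = c.1.2 → ¬ (entry c).Marked

/-- The exponent vector of the monomial `x^T = ∏ x_{|T(c)|}` over the cells `c`. -/
def MarkedShiftedTableau.weight {n : ℕ} {lam : n.Partition} (T : MarkedShiftedTableau lam) :
    ℕ →₀ ℕ :=
  ∑ c, Finsupp.single (T.entry c).abs 1

/-- Schur's P-function `P_λ = ∑ T, x^T`, `λ` with distinct parts: the coefficient of `x^d` is the
(finite) number of marked shifted tableaux `T` of shape `λ` and weight `d` with unmarked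
diagonal. -/
def schurP {n : ℕ} (lam : n.Partition) : Series :=
  fun d => (Nat.card {T : MarkedShiftedTableau lam // T.weight = d} : ℚ)

/-- The value `f(1^m)` of a series of bounded degree at `x_i = 1` for the first `m` variables and
`x_i = 0` for the others: the sum of the coefficients of the monomials in the first `m` variables
(a finite sum). -/
def evalOnes (m : ℕ) (f : Series) : ℚ :=
  ∑ᶠ (d : ℕ →₀ ℕ) (_ : ∀ i, m ≤ i → d i = 0), MvPowerSeries.coeff d f

end ShiftedParking

end

/-
Every map from the `n` cars to a circle of `n + 1` spots has exactly one translate that is a parking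
function (Pollak), so the character of the parking representation at `w` is `(n + 1) ^ (c(w) - 1)`,
where `c(w)` is the number of cycles of `w`. Hence `(n + 1) SH_n(x)` is the cycle index of the
symmetric group at `p_k ↦ (n + 1) p_k(x/x)`, which is the part of degree `n` of
`∏ i, ((1 + x_i) / (1 - x_i)) ^ (n + 1)`. This is the kernel of the Cauchy identity
`∏ i j, (1 + x_i y_j) / (1 - x_i y_j) = ∑ λ, 2 ^ ℓ(λ) P_λ(x) P_λ(y)` at `y = 1^(n+1)`.

For the Cauchy identity it is enough to take finitely many variables `x_i` and `y_j`. Each `x_i`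
then acts on strict partitions by adding a strip, and each `y_j` by removing one. Moving the removal
operators past all the additions, until they act trivially on the empty partition, produces the
kernel: an addition and a removal commute up to the factor `(1 + x y) / (1 - x y)`. This exchange
relation is proved by scanning the diagonals of the shifted diagrams one at a time.
-/

noncomputable section

namespace ShiftedParking

variable {R : Type*} [CommRing R]

/-! ### Strict partitions as finite sets -/

/-- The number of cells of content `p` in the shifted diagram of the strict partition `A`; here and
below a strict partition is encoded by the finite set `A` of all `a` such that `a + 1` is a part. -/
def diagLen (A : Finset ℕ) (p : ℕ) : ℕ := (A.filter (p ≤ ·)).card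

/-- The number of cells of the shifted diagram of the strict partition encoded by `A`. -/
def size (A : Finset ℕ) : ℕ := ∑ a ∈ A, (a + 1)

/-- The indicator function of `A`, with values in `ℤ`. -/
def bit (A : Finset ℕ) (p : ℕ) : ℤ := if p ∈ A then 1 else 0

theorem diagLen_zero (A : Finset ℕ) : diagLen A 0 = A.card := by
  simp [diagLen]

theorem diagLen_eq_add_ite (A : Finset ℕ) (p : ℕ) :
    diagLen A p = diagLen A (p + 1) + if p ∈ A then 1 else 0 := by
  have h : A.filter (p ≤ ·) = A.filter (p + 1 ≤ ·) ∪ A.filter (p = ·) := by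
    ext a
    grind
  rw [diagLen, diagLen, h, Finset.card_union_of_disjoint, Finset.filter_eq]
  · split_ifs <;> rfl
  · exact Finset.disjoint_filter.2 fun a _ _ => by omega

theorem diagLen_succ_le (A : Finset ℕ) (p : ℕ) : diagLen A (p + 1) ≤ diagLen A p := by
  rw [diagLen_eq_add_ite A p]
  omega

theorem diagLen_le_succ_add_one (A : Finset ℕ) (p : ℕ) : diagLen A p ≤ diagLen A (p + 1) + 1 := by
  rw [diagLen_eq_add_ite A p]
  split_ifs <;> omega

theorem diagLen_injective : Function.Injective diagLen := fun A B h => by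
  have hmem (C : Finset ℕ) (p : ℕ) : p ∈ C ↔ diagLen C p = diagLen C (p + 1) + 1 := by
    rw [diagLen_eq_add_ite C p]
    split_ifs with hp <;> simp [hp]
  ext p
  rw [hmem, hmem, h]

theorem diagLen_sub_add_bit (B A : Finset ℕ) (p : ℕ) :
    (diagLen A (p + 1) : ℤ) - diagLen B (p + 1) + bit A p - bit B p =
      diagLen A p - diagLen B p := by
  rw [diagLen_eq_add_ite A p, diagLen_eq_add_ite B p]
  push_cast [bit]
  ring

theorem diagLen_eq_zero {A : Finset ℕ} {L p : ℕ} (hA : A ⊆ Finset.range L) (hp : L ≤ p) :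
    diagLen A p = 0 := by
  rw [diagLen, Finset.card_eq_zero, Finset.filter_eq_empty_iff]
  exact fun a ha => not_le.2 ((Finset.mem_range.1 (hA ha)).trans_le hp)

theorem exists_diagLen_eq {L : ℕ} (c : ℕ → ℕ) (hzero : ∀ p, L ≤ p → c p = 0)
    (hanti : ∀ p, c (p + 1) ≤ c p) (hstep : ∀ p, c p ≤ c (p + 1) + 1) :
    ∃ B ⊆ Finset.range L, ∀ p, diagLen B p = c p := by
  set B := (Finset.range L).filter fun p => c p ≠ c (p + 1) with hB
  have hBL : B ⊆ Finset.range L := Finset.filter_subset _ _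
  have hge (p : ℕ) (hp : L ≤ p) : diagLen B p = c p := by rw [hzero p hp, diagLen_eq_zero hBL hp]
  refine ⟨B, hBL, fun p => (le_total L p).elim (hge p) fun hp => ?_⟩
  induction hp using Nat.decreasingInduction with
  | self => exact hge L le_rfl
  | of_succ p hp ih =>
    have := hanti p
    have := hstep p
    rw [diagLen_eq_add_ite, ih]
    simp only [hB, Finset.mem_filter, Finset.mem_range, hp, true_and]
    split_ifs <;> omega

theorem size_eq_sum_diagLen {A : Finset ℕ} {L : ℕ} (hA : A ⊆ Finset.range L) :
    size A = ∑ p ∈ Finset.range L, diagLen A p := by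
  simp only [diagLen, Finset.card_filter]
  rw [Finset.sum_comm, size]
  refine Finset.sum_congr rfl fun a ha => ?_
  have h : (Finset.range L).filter (· ≤ a) = Finset.range (a + 1) := by
    ext p
    have := Finset.mem_range.1 (hA ha)
    simp only [Finset.mem_filter, Finset.mem_range]
    omega
  rw [← Finset.card_filter, h, Finset.card_range]

theorem size_eq_zero_iff {A : Finset ℕ} : size A = 0 ↔ A = ∅ := by
  simp [size, Finset.sum_eq_zero_iff, Finset.eq_empty_iff_forall_notMem]

theorem size_insert {A : Finset ℕ} {L : ℕ} (hL : L ∉ A) : size (insert L A) = L + 1 + size A :=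
  Finset.sum_insert hL

theorem sum_powerset_range_succ {M : Type*} [AddCommMonoid M] (L : ℕ) (f : Finset ℕ → M) :
    ∑ A ∈ (Finset.range (L + 1)).powerset, f A =
      ∑ A ∈ (Finset.range L).powerset, (f A + f (insert L A)) := by
  rw [Finset.range_add_one, Finset.sum_powerset_insert Finset.notMem_range_self,
    Finset.sum_add_distrib]

theorem notMem_of_mem_powerset_range {A : Finset ℕ} {L : ℕ}
    (hA : A ∈ (Finset.range L).powerset) : L ∉ A := fun h =>
  Finset.notMem_range_self (Finset.mem_powerset.1 hA h)

/-! ### Transfer weights -/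

/-- The weight of a diagonal of a skew shape on which there are `e` cells: such a diagonal may
carry at most one cell, whose weight is `y`. -/
def edgeFactor (y : R) (e : ℤ) : R := if e = 0 then 1 else if e = 1 then y else 0

/-- The weight of the part of content at most `L` of the skew shape `A / B` with `e` cells of
content `L`, computed by scanning the contents downwards.  A cell of content `0` has weight `c`;
a cell of content `p + 1` has a weight `w b a` that depends on whether `p` belongs to `B` and
to `A`. -/
def transferWeight (c : R) (w : Bool → Bool → R) (B A : Finset ℕ) : ℕ → ℤ → R
  | 0, e => edgeFactor c e
  | L + 1, e =>
    edgeFactor (w (L ∈ B) (L ∈ A)) e * transferWeight c w B A L (e + bit A L - bit B L)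

section transferWeight

variable (c : R) (w : Bool → Bool → R) (B A : Finset ℕ) (L : ℕ)

theorem edgeFactor_eq_zero (y : R) {e : ℤ} (he : e ≠ 0 ∧ e ≠ 1) : edgeFactor y e = 0 := by
  simp [edgeFactor, he]

theorem transferWeight_eq_zero {e : ℤ} (he : e ≠ 0 ∧ e ≠ 1) :
    transferWeight c w B A L e = 0 := by
  cases L <;> simp [transferWeight, edgeFactor_eq_zero _ he]

variable {B A} in
theorem transferWeight_congr {B' A' : Finset ℕ} (hB : ∀ p < L, p ∈ B ↔ p ∈ B')
    (hA : ∀ p < L, p ∈ A ↔ p ∈ A') (e : ℤ) :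
    transferWeight c w B A L e = transferWeight c w B' A' L e := by
  induction L generalizing e with
  | zero => rfl
  | succ L ih =>
    simp only [transferWeight, bit, hB L L.lt_succ_self, hA L L.lt_succ_self]
    rw [ih (fun p hp => hB p (by omega)) fun p hp => hA p (by omega)]

theorem transferWeight_insert_left (e : ℤ) :
    transferWeight c w (insert L B) A L e = transferWeight c w B A L e :=
  transferWeight_congr c w L (fun p hp => by simp [hp.ne]) (fun _ _ => Iff.rfl) e

theorem transferWeight_insert_right (e : ℤ) :
    transferWeight c w B (insert L A) L e = transferWeight c w B A L e :=
  transferWeight_congr c w L (fun _ _ => Iff.rfl) (fun p hp => by simp [hp.ne]) e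

theorem map_transferWeight {S : Type*} [CommRing S] (f : R →+* S) (e : ℤ) :
    f (transferWeight c w B A L e) = transferWeight (f c) (fun b a => f (w b a)) B A L e := by
  induction L generalizing e with
  | zero => simp only [transferWeight, edgeFactor]; split_ifs <;> simp
  | succ L ih => simp only [transferWeight, edgeFactor, map_mul, ih]; split_ifs <;> simp

theorem transferWeight_diagLen :
    transferWeight c w B A L (diagLen A L - diagLen B L) =
      edgeFactor c (diagLen A 0 - diagLen B 0) *
        ∏ p ∈ Finset.range L,
          edgeFactor (w (p ∈ B) (p ∈ A)) (diagLen A (p + 1) - diagLen B (p + 1)) := by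
  induction L with
  | zero => simp [transferWeight]
  | succ L ih =>
    rw [transferWeight, diagLen_sub_add_bit, ih, Finset.prod_range_succ]
    ring

variable {B A L} in
theorem transferWeight_eq_prod (hB : B ⊆ Finset.range L) (hA : A ⊆ Finset.range L) :
    transferWeight c w B A L 0 =
      edgeFactor c (diagLen A 0 - diagLen B 0) *
        ∏ p ∈ Finset.range L,
          edgeFactor (w (p ∈ B) (p ∈ A)) (diagLen A (p + 1) - diagLen B (p + 1)) := by
  simp [← transferWeight_diagLen, diagLen_eq_zero hA, diagLen_eq_zero hB]

theorem edgeFactor_mul_pow (t y : R) (a b : ℕ) :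
    edgeFactor (t * y) ((a : ℤ) - b) * t ^ b = t ^ a * edgeFactor y ((a : ℤ) - b) := by
  by_cases h0 : (a : ℤ) - b = 0
  · obtain rfl : a = b := by omega
    simp [edgeFactor]
  by_cases h1 : (a : ℤ) - b = 1
  · obtain rfl : a = b + 1 := by omega
    simp only [edgeFactor, if_neg h0, if_pos h1]
    ring
  · simp [edgeFactor_eq_zero _ ⟨h0, h1⟩]

variable {B A L} in
theorem transferWeight_mul_pow (t : R) (hB : B ⊆ Finset.range L) (hA : A ⊆ Finset.range L) :
    transferWeight (t * c) (fun b a => t * w b a) B A L 0 * t ^ size B =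
      t ^ size A * transferWeight c w B A L 0 := by
  have hpow {C : Finset ℕ} (hC : C ⊆ Finset.range L) :
      t ^ size C = t ^ diagLen C 0 * ∏ p ∈ Finset.range L, t ^ diagLen C (p + 1) := by
    rw [size_eq_sum_diagLen (hC.trans (Finset.range_subset_range.2 L.le_succ)),
      Finset.sum_range_succ', add_comm, pow_add, Finset.prod_pow_eq_pow_sum]
  rw [transferWeight_eq_prod _ _ hB hA, transferWeight_eq_prod _ _ hB hA, hpow hB, hpow hA,
    mul_mul_mul_comm, edgeFactor_mul_pow, ← Finset.prod_mul_distrib]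
  simp only [edgeFactor_mul_pow, Finset.prod_mul_distrib]
  ring

end transferWeight

/-! ### Exchange relations for strips -/

/-- The weight of the part of content at most `L` of the strip `A / B` with `e` cells of content
`L`: each cell has weight `x`, with an extra factor `2` for each connected component that does not
meet the diagonal of content `0`, and an extra factor `z` for the component that does. -/
def stripWeight (z x : R) : Finset ℕ → Finset ℕ → ℕ → ℤ → R :=
  transferWeight (z * x) fun b a => if b && !a then 2 * x else x

section stripWeight

variable (z x : R)

theorem stripWeight_mul_pow_size (t : R) {B A : Finset ℕ} {L : ℕ} (hB : B ⊆ Finset.range L)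
    (hA : A ⊆ Finset.range L) :
    stripWeight z (t * x) B A L 0 * t ^ size B = t ^ size A * stripWeight z x B A L 0 := by
  have hw : (fun b a : Bool => if b && !a then 2 * (t * x) else t * x) =
      fun b a => t * if b && !a then 2 * x else x := by
    funext b a
    split_ifs <;> ring
  rw [stripWeight, stripWeight, ← transferWeight_mul_pow _ _ t hB hA, mul_left_comm z t x, hw]

theorem stripWeight_mul_pow_card {B A : Finset ℕ} {L : ℕ} (hB : B ⊆ Finset.range L)
    (hA : A ⊆ Finset.range L) :
    stripWeight z x B A L 0 * z ^ B.card = z ^ A.card * stripWeight 1 x B A L 0 := by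
  rw [stripWeight, stripWeight, transferWeight_eq_prod _ _ hB hA, transferWeight_eq_prod _ _ hB hA,
    ← diagLen_zero, ← diagLen_zero, ← mul_assoc, one_mul, ← edgeFactor_mul_pow]
  ring

theorem stripWeight_empty_right {B : Finset ℕ} {L : ℕ} (hB : B ⊆ Finset.range L) :
    stripWeight z x B ∅ L 0 = if B = ∅ then 1 else 0 := by
  split_ifs with h
  · subst h
    rw [stripWeight, transferWeight_eq_prod _ _ hB hB]
    simp [edgeFactor]
  · have h0 := stripWeight_mul_pow_size z x 0 hB (Finset.empty_subset _)
    rw [zero_pow (size_eq_zero_iff.not.2 h), mul_zero, show size ∅ = 0 from rfl, pow_zero,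
      one_mul] at h0
    exact h0.symm

theorem stripWeight_one_eq_insert {B : Finset ℕ} (A : Finset ℕ) {L : ℕ} (hL : L ∉ B) :
    stripWeight z x B A L 1 = stripWeight z x B (insert L A) (L + 1) 0 := by
  simp [stripWeight, transferWeight, transferWeight_insert_right, edgeFactor, bit, hL]

theorem map_stripWeight {S : Type*} [CommRing S] (f : R →+* S) (B A : Finset ℕ) (L : ℕ) (e : ℤ) :
    f (stripWeight z x B A L e) = stripWeight (f z) (f x) B A L e := by
  rw [stripWeight, stripWeight, map_transferWeight, map_mul]
  congr! 3
  split_ifs <;> simp [map_ofNat]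

end stripWeight

/-- The sum over the shapes `μ ⊆ {0, …, L - 1}` of the weights of the strips `μ / β` and `μ / α`
with `e` and `f` cells of content `L`. -/
def upSum (x y : R) (α β : Finset ℕ) (L : ℕ) (e f : ℤ) : R :=
  ∑ μ ∈ (Finset.range L).powerset, stripWeight 1 x β μ L e * stripWeight 2 y α μ L f

/-- The sum over the shapes `ν ⊆ {0, …, L - 1}` of the weights of the strips `α / ν` and `β / ν`
with `e` and `f` cells of content `L`. -/
def downSum (x y : R) (α β : Finset ℕ) (L : ℕ) (e f : ℤ) : R :=
  ∑ ν ∈ (Finset.range L).powerset, stripWeight 1 x ν α L e * stripWeight 2 y ν β L f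

section exchange

variable (x y : R) (α β : Finset ℕ) (L : ℕ)

theorem upSum_succ (e f : ℤ) :
    upSum x y α β (L + 1) e f =
      edgeFactor (if L ∈ β then 2 * x else x) e * edgeFactor (if L ∈ α then 2 * y else y) f *
        upSum x y α β L (e - bit β L) (f - bit α L) +
      edgeFactor x e * edgeFactor y f * upSum x y α β L (e + 1 - bit β L) (f + 1 - bit α L) := by
  simp only [upSum, sum_powerset_range_succ, Finset.sum_add_distrib, Finset.mul_sum]
  congr 1 <;> refine Finset.sum_congr rfl fun μ hμ => ?_
  · have hL := notMem_of_mem_powerset_range hμ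
    simp only [stripWeight, transferWeight, bit, hL, if_false, decide_false, Bool.not_false,
      Bool.and_true, decide_eq_true_eq, add_zero]
    ring
  · simp only [stripWeight, transferWeight, transferWeight_insert_right]
    simp only [bit, Finset.mem_insert_self, if_true, decide_true, Bool.not_true, Bool.and_false,
      Bool.false_eq_true, if_false]
    ring

theorem downSum_succ (e f : ℤ) :
    downSum x y α β (L + 1) e f =
      edgeFactor x e * edgeFactor y f * downSum x y α β L (e + bit α L) (f + bit β L) +
      edgeFactor (if L ∈ α then x else 2 * x) e * edgeFactor (if L ∈ β then y else 2 * y) f *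
        downSum x y α β L (e + bit α L - 1) (f + bit β L - 1) := by
  simp only [downSum, sum_powerset_range_succ, Finset.sum_add_distrib, Finset.mul_sum]
  congr 1 <;> refine Finset.sum_congr rfl fun ν hν => ?_
  · have hL := notMem_of_mem_powerset_range hν
    simp only [stripWeight, transferWeight, bit, hL, decide_false, Bool.false_and,
      Bool.false_eq_true, if_false, sub_zero]
    ring
  · simp only [stripWeight, transferWeight, transferWeight_insert_left]
    simp only [bit, Finset.mem_insert_self, decide_true, Bool.true_and, Bool.not_eq_true',
      decide_eq_false_iff_not, ite_not, if_true]
    ring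

theorem upSum_eq_zero {e f : ℤ} (h : (e ≠ 0 ∧ e ≠ 1) ∨ (f ≠ 0 ∧ f ≠ 1)) :
    upSum x y α β L e f = 0 := by
  refine Finset.sum_eq_zero fun μ _ => ?_
  rcases h with h | h <;> simp [stripWeight, transferWeight_eq_zero _ _ _ _ _ h]

theorem downSum_eq_zero {e f : ℤ} (h : (e ≠ 0 ∧ e ≠ 1) ∨ (f ≠ 0 ∧ f ≠ 1)) :
    downSum x y α β L e f = 0 := by
  refine Finset.sum_eq_zero fun ν _ => ?_
  rcases h with h | h <;> simp [stripWeight, transferWeight_eq_zero _ _ _ _ _ h]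

/- Each of the four relations at `L` enters the first one at `L + 1`: they are proved together. -/
theorem exchange :
    (1 - x * y) * upSum x y α β L 0 0 + upSum x y α β L 1 1 =
        (1 + x * y) * downSum x y α β L 0 0 ∧
      2 * upSum x y α β L 0 0 + upSum x y α β L 1 1 =
        2 * downSum x y α β L 0 0 + downSum x y α β L 1 1 ∧
      upSum x y α β L 1 0 = downSum x y α β L 1 0 ∧
      upSum x y α β L 0 1 = downSum x y α β L 0 1 := by
  induction L with
  | zero =>
    simp only [upSum, downSum, stripWeight, transferWeight, edgeFactor, Finset.range_zero,
      Finset.powerset_empty, Finset.sum_singleton]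
    refine ⟨?_, ?_, ?_, ?_⟩ <;> norm_num
    ring
  | succ L ih =>
    obtain ⟨h00, h11, h10, h01⟩ := ih
    have hup (e f : ℤ) (h : e = -1 ∨ e = 2 ∨ f = -1 ∨ f = 2) : upSum x y α β L e f = 0 :=
      upSum_eq_zero x y α β L (by omega)
    have hdown (e f : ℤ) (h : e = -1 ∨ e = 2 ∨ f = -1 ∨ f = 2) : downSum x y α β L e f = 0 :=
      downSum_eq_zero x y α β L (by omega)
    by_cases hα : L ∈ α <;> by_cases hβ : L ∈ β <;>
      simp only [upSum_succ, downSum_succ, edgeFactor, bit, hα, hβ, if_true, if_false] <;>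
      norm_num [hup, hdown]
    · exact ⟨by linear_combination (1 + x * y) * h11 - h00,
        by linear_combination (2 + x * y) * h11 - 2 * h00, by rw [h10], by rw [h01]⟩
    · exact ⟨by linear_combination (1 + x * y) * h10, by linear_combination (2 + 2 * x * y) * h10,
        by linear_combination y * h11⟩
    · exact ⟨by linear_combination (1 + x * y) * h01, by linear_combination (2 + 2 * x * y) * h01,
        by linear_combination x * h11⟩
    · exact ⟨by linear_combination h00, by linear_combination x * y * h11 + 2 * h00, by rw [h10],
        by rw [h01]⟩

end exchange

/-! ### The Cauchy identity -/

/-- The strict partitions with parts at most `L`. -/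
abbrev Shape (L : ℕ) : Type := (Finset.range L).powerset

/-- The empty partition. -/
def Shape.empty (L : ℕ) : Shape L := ⟨∅, Finset.empty_mem_powerset _⟩

theorem Shape.val_eq_empty_iff {L : ℕ} {A : Shape L} : A.1 = ∅ ↔ A = Shape.empty L :=
  (Subtype.ext_iff (a2 := Shape.empty L)).symm

theorem Shape.subset {L : ℕ} (A : Shape L) : A.1 ⊆ Finset.range L := Finset.mem_powerset.1 A.2

/-- The matrix of the weights of the strips between shapes, in one variable `x`. -/
def stripMatrix (z : R) (L : ℕ) (x : R) : Matrix (Shape L) (Shape L) R :=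
  .of fun B A => stripWeight z x B A L 0

/-- The vector of the values at `x 0, …, x (N - 1)` of Schur's `P`-functions for `z = 1` and of
Schur's `Q`-functions `2 ^ ℓ P` for `z = 2`, computed by peeling off a strip for each variable. -/
def shiftedSchur (z : R) (L : ℕ) (x : ℕ → R) : ℕ → Shape L → R
  | 0 => Pi.single (Shape.empty L) 1
  | N + 1 => Matrix.vecMul (shiftedSchur z L x N) (stripMatrix z L (x N))

section shiftedSchur

open Matrix

variable (z : R) (L : ℕ) (x : ℕ → R) (N : ℕ)

theorem shiftedSchur_succ_apply (A : Shape L) :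
    shiftedSchur z L x (N + 1) A =
      ∑ B : Shape L, shiftedSchur z L x N B * stripWeight z (x N) B A L 0 :=
  rfl

theorem shiftedSchur_const_mul (t : R) (A : Shape L) :
    shiftedSchur z L (fun i => t * x i) N A = t ^ size A * shiftedSchur z L x N A := by
  induction N generalizing A with
  | zero =>
    rcases eq_or_ne A (Shape.empty L) with rfl | hA
    · simp [shiftedSchur, show size (Shape.empty L).1 = 0 from rfl]
    · simp [shiftedSchur, hA]
  | succ N ih =>
    rw [shiftedSchur_succ_apply, shiftedSchur_succ_apply, Finset.mul_sum]
    refine Finset.sum_congr rfl fun B _ => ?_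
    rw [ih, mul_right_comm, mul_comm (t ^ size B.1),
      stripWeight_mul_pow_size z _ t B.subset A.subset]
    ring

theorem shiftedSchur_eq_pow_card_mul (A : Shape L) :
    shiftedSchur z L x N A = z ^ A.1.card * shiftedSchur 1 L x N A := by
  induction N generalizing A with
  | zero =>
    rcases eq_or_ne A (Shape.empty L) with rfl | hA
    · simp [shiftedSchur, show (Shape.empty L).1 = ∅ from rfl]
    · simp [shiftedSchur, hA]
  | succ N ih =>
    rw [shiftedSchur_succ_apply, shiftedSchur_succ_apply, Finset.mul_sum]
    refine Finset.sum_congr rfl fun B _ => ?_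
    rw [ih, mul_right_comm, mul_comm (z ^ B.1.card),
      stripWeight_mul_pow_card z _ B.subset A.subset]
    ring

theorem shiftedSchur_empty : shiftedSchur z L x N (Shape.empty L) = 1 := by
  induction N with
  | zero => simp [shiftedSchur]
  | succ N ih =>
    rw [shiftedSchur_succ_apply, Finset.sum_eq_single (Shape.empty L), ih, one_mul]
    · exact (stripWeight_empty_right z _ (Finset.empty_subset _)).trans (if_pos rfl)
    · intro B _ hB
      exact mul_eq_zero_of_right _
        ((stripWeight_empty_right z _ B.subset).trans (if_neg (Shape.val_eq_empty_iff.not.2 hB)))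
    · simp

theorem map_shiftedSchur {S : Type*} [CommRing S] (f : R →+* S) (A : Shape L) :
    f (shiftedSchur z L x N A) = shiftedSchur (f z) L (fun i => f (x i)) N A := by
  induction N generalizing A with
  | zero =>
    rcases eq_or_ne A (Shape.empty L) with rfl | hA
    · simp [shiftedSchur]
    · simp [shiftedSchur, hA]
  | succ N ih => simp [shiftedSchur_succ_apply, ih, map_stripWeight]

/- The shapes with at most `L` columns are not closed under adding strips. With all variables
multiplied by a `t` such that `t ^ (L + 1) = 0`, the missing shapes have weight `0`. -/
theorem shiftedSchur_mul_stripWeight_eq_zero {t : R} (ht : t ^ (L + 1) = 0) (a : R)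
    (B A : Shape L) :
    shiftedSchur 1 L (fun i => t * x i) N B * stripWeight 1 (t * a) B A L 1 = 0 := by
  have hL (A : Shape L) : L ∉ A.1 := notMem_of_mem_powerset_range A.2
  have hB : B.1 ⊆ Finset.range (L + 1) := B.subset.trans (by simp)
  have hA : insert L A.1 ⊆ Finset.range (L + 1) :=
    Finset.insert_subset (by simp) (A.subset.trans (by simp))
  rw [stripWeight_one_eq_insert _ _ _ (hL B), shiftedSchur_const_mul, mul_right_comm,
    mul_comm (t ^ _), stripWeight_mul_pow_size 1 _ t hB hA, size_insert (hL A), pow_add, ht]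
  ring

theorem shiftedSchur_vecMul_stripMatrix_comm {t : R} (ht : t ^ (L + 1) = 0) (a y : R) :
    (1 - t * a * y) • (shiftedSchur 1 L (fun i => t * x i) N ᵥ*
        (stripMatrix 1 L (t * a) * (stripMatrix 2 L y)ᵀ)) =
      (1 + t * a * y) • (shiftedSchur 1 L (fun i => t * x i) N ᵥ*
        ((stripMatrix 2 L y)ᵀ * stripMatrix 1 L (t * a))) := by
  set v := shiftedSchur 1 L (fun i => t * x i) N
  have hup (β α : Shape L) : (stripMatrix 1 L (t * a) * (stripMatrix 2 L y)ᵀ) β α =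
      upSum (t * a) y α β L 0 0 :=
    Finset.sum_coe_sort (Finset.range L).powerset fun μ =>
      stripWeight 1 (t * a) β μ L 0 * stripWeight 2 y α μ L 0
  have hdown (β α : Shape L) : ((stripMatrix 2 L y)ᵀ * stripMatrix 1 L (t * a)) β α =
      downSum (t * a) y α β L 0 0 := by
    rw [downSum, ← Finset.sum_coe_sort, Matrix.mul_apply]
    exact Finset.sum_congr rfl fun ν _ => mul_comm (stripMatrix 2 L y ν β) _
  have hboundary (β α : Shape L) : v β * upSum (t * a) y α β L 1 1 = 0 := by
    rw [upSum, ← Finset.sum_coe_sort, Finset.mul_sum]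
    refine Finset.sum_eq_zero fun μ _ => ?_
    rw [← mul_assoc, shiftedSchur_mul_stripWeight_eq_zero L x N ht, zero_mul]
  ext α
  simp only [Pi.smul_apply, vecMul, dotProduct, smul_eq_mul, Finset.mul_sum, hup, hdown]
  refine Finset.sum_congr rfl fun β _ => ?_
  linear_combination v β * (exchange (t * a) y α β L).1 - hboundary β α

theorem prod_smul_shiftedSchur_vecMul {t : R} (ht : t ^ (L + 1) = 0) (y : R) :
    (∏ i ∈ Finset.range N, (1 - t * x i * y)) •
        (shiftedSchur 1 L (fun i => t * x i) N ᵥ* (stripMatrix 2 L y)ᵀ) =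
      (∏ i ∈ Finset.range N, (1 + t * x i * y)) • shiftedSchur 1 L (fun i => t * x i) N := by
  induction N with
  | zero =>
    ext A
    have h : stripMatrix 2 L y A (Shape.empty L) = if A.1 = ∅ then 1 else 0 :=
      stripWeight_empty_right 2 y A.subset
    simp [shiftedSchur, h, Pi.single_apply, Shape.val_eq_empty_iff]
  | succ N ih =>
    rw [shiftedSchur, vecMul_vecMul, Finset.prod_range_succ, mul_smul,
      shiftedSchur_vecMul_stripMatrix_comm L x N ht, smul_comm, ← vecMul_vecMul, ← smul_vecMul, ih,
      smul_vecMul, smul_smul, Finset.prod_range_succ, mul_comm]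

theorem prod_mul_shiftedSchur_dotProduct {t : R} (ht : t ^ (L + 1) = 0) (y : ℕ → R) (m : ℕ) :
    (∏ j ∈ Finset.range m, ∏ i ∈ Finset.range N, (1 - t * x i * y j)) *
        (shiftedSchur 1 L (fun i => t * x i) N ⬝ᵥ shiftedSchur 2 L y m) =
      ∏ j ∈ Finset.range m, ∏ i ∈ Finset.range N, (1 + t * x i * y j) := by
  induction m with
  | zero => simp [shiftedSchur, shiftedSchur_empty]
  | succ m ih =>
    rw [shiftedSchur, ← mulVec_transpose, dotProduct_mulVec, Finset.prod_range_succ, mul_assoc,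
      ← smul_eq_mul (∏ i ∈ Finset.range N, (1 - t * x i * y m)), ← smul_dotProduct,
      prod_smul_shiftedSchur_vecMul L x N ht, smul_dotProduct, smul_eq_mul, mul_left_comm, ih,
      Finset.prod_range_succ, mul_comm]

end shiftedSchur

section coeff

open PowerSeries

variable (x y : ℕ → R) (N m : ℕ)

/- The Cauchy identity is applied in `R⟦X⟧ ⧸ (X ^ (n + 1))` with `t = X`. -/
theorem X_pow_dvd_cauchy (n : ℕ) :
    (X : R⟦X⟧) ^ (n + 1) ∣
      (∏ j ∈ Finset.range m, ∏ i ∈ Finset.range N, (1 - X * C (x i) * C (y j))) *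
          (∑ A : Shape n, X ^ size A * C (shiftedSchur 1 n x N A * shiftedSchur 2 n y m A)) -
        ∏ j ∈ Finset.range m, ∏ i ∈ Finset.range N, (1 + X * C (x i) * C (y j)) := by
  let q := Ideal.Quotient.mk (Ideal.span {(X : R⟦X⟧) ^ (n + 1)})
  have ht : q X ^ (n + 1) = 0 := by
    rw [← map_pow]
    exact Ideal.Quotient.eq_zero_iff_mem.2 (Ideal.mem_span_singleton_self _)
  rw [← Ideal.mem_span_singleton, ← Ideal.Quotient.mk_eq_mk_iff_sub_mem]
  convert prod_mul_shiftedSchur_dotProduct n (fun i => q (C (x i))) N ht (fun j => q (C (y j))) m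
    using 1
  · rw [map_mul]
    congr 1
    · simp [q]
    · rw [map_sum]
      refine Finset.sum_congr rfl fun A _ => ?_
      have hx := map_shiftedSchur 1 n x N (q.comp C) A
      have hy := map_shiftedSchur 2 n y m (q.comp C) A
      rw [map_one] at hx
      rw [map_ofNat] at hy
      simp only [RingHom.comp_apply] at hx hy
      rw [shiftedSchur_const_mul, ← hx, ← hy]
      simp [q, mul_assoc]
  · simp [q]

theorem coeff_cauchy {H : R⟦X⟧}
    (hH : (∏ j ∈ Finset.range m, ∏ i ∈ Finset.range N, (1 - X * C (x i) * C (y j))) * H =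
      ∏ j ∈ Finset.range m, ∏ i ∈ Finset.range N, (1 + X * C (x i) * C (y j))) (n : ℕ) :
    coeff n H =
      ∑ A : Shape n with size A.1 = n, shiftedSchur 1 n x N A * shiftedSchur 2 n y m A := by
  have hunit : IsUnit (∏ j ∈ Finset.range m, ∏ i ∈ Finset.range N,
      (1 - X * C (x i) * C (y j)) : R⟦X⟧) := by
    simp [PowerSeries.isUnit_iff_constantCoeff]
  have hdvd := X_pow_dvd_cauchy x y N m n
  rw [← hH, ← mul_sub, hunit.dvd_mul_left, X_pow_dvd_iff] at hdvd
  have hcoeff := hdvd n n.lt_succ_self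
  rw [map_sub, sub_eq_zero] at hcoeff
  rw [← hcoeff, map_sum, Finset.sum_filter]
  refine Finset.sum_congr rfl fun A _ => ?_
  rw [coeff_X_pow_mul', coeff_C]
  grind

end coeff

/-! ### Vertical and horizontal strips -/

/-- The weight of the part of content at most `L` of the vertical strip `A / B`, with no cell on
the main diagonal and `e` cells of content `L`: the strip carries a marked letter of weight `x`. -/
def vertWeight (x : R) : Finset ℕ → Finset ℕ → ℕ → ℤ → R :=
  transferWeight 0 fun b _ => if b then x else 0

/-- The weight of the part of content at most `L` of the horizontal strip `A / B` with `e` cells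
of content `L`: the strip carries an unmarked letter of weight `x`. -/
def horizWeight (x : R) : Finset ℕ → Finset ℕ → ℕ → ℤ → R :=
  transferWeight x fun _ a => if !a then x else 0

/-- The generating function of the ways to fill the part of content at most `L` of the skew shape
`A / B` with a vertical strip of marked letters, `v` of them of content `L`, followed by a
horizontal strip of unmarked letters, `h` of them of content `L`. -/
def markedSum (x : R) (B A : Finset ℕ) (L : ℕ) (v h : ℤ) : R :=
  ∑ C ∈ (Finset.range L).powerset, vertWeight x B C L v * horizWeight x C A L h

section markedSum

variable (x : R) (B A : Finset ℕ) (L : ℕ)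

theorem markedSum_eq_zero {v h : ℤ} (hvh : (v ≠ 0 ∧ v ≠ 1) ∨ (h ≠ 0 ∧ h ≠ 1)) :
    markedSum x B A L v h = 0 := by
  refine Finset.sum_eq_zero fun C _ => ?_
  rcases hvh with h | h <;>
    simp [vertWeight, horizWeight, transferWeight_eq_zero _ _ _ _ _ h]

theorem markedSum_succ (v h : ℤ) :
    markedSum x B A (L + 1) v h =
      edgeFactor (if L ∈ B then x else 0) v * edgeFactor (if L ∉ A then x else 0) h *
        (markedSum x B A L (v - bit B L) (h + bit A L) +
          markedSum x B A L (v + 1 - bit B L) (h + bit A L - 1)) := by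
  rw [mul_add]
  simp only [markedSum, sum_powerset_range_succ, Finset.sum_add_distrib, Finset.mul_sum]
  congr 1 <;> refine Finset.sum_congr rfl fun C hC => ?_
  · have hL := notMem_of_mem_powerset_range hC
    simp only [vertWeight, horizWeight, transferWeight, bit, hL, if_false, decide_eq_true_eq,
      Bool.not_eq_true', decide_eq_false_iff_not, add_zero, sub_zero]
    ring
  · simp only [vertWeight, horizWeight, transferWeight, transferWeight_insert_left,
      transferWeight_insert_right]
    simp only [bit, Finset.mem_insert_self, if_true, decide_eq_true_eq,
      Bool.not_eq_true', decide_eq_false_iff_not]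
    ring

theorem stripWeight_one_eq_markedSum :
    stripWeight 1 x B A L 0 = markedSum x B A L 0 0 ∧
      stripWeight 1 x B A L 1 = markedSum x B A L 1 0 + markedSum x B A L 0 1 := by
  induction L with
  | zero => simp [stripWeight, markedSum, vertWeight, horizWeight, transferWeight, edgeFactor]
  | succ L ih =>
    obtain ⟨h0, h1⟩ := ih
    have hmarked (v h : ℤ) (hvh : v = -1 ∨ v = 2 ∨ h = -1 ∨ h = 2) : markedSum x B A L v h = 0 :=
      markedSum_eq_zero x B A L (by omega)
    have hstrip (e : ℤ) (he : e = -1 ∨ e = 2) : stripWeight 1 x B A L e = 0 :=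
      transferWeight_eq_zero _ _ _ _ _ (by omega)
    have hsucc (e : ℤ) : stripWeight 1 x B A (L + 1) e =
        edgeFactor (if L ∈ B ∧ L ∉ A then 2 * x else x) e *
          stripWeight 1 x B A L (e + bit A L - bit B L) := by
      simp [stripWeight, transferWeight]
    by_cases hA : L ∈ A <;> by_cases hB : L ∈ B <;>
      simp only [hsucc, markedSum_succ, edgeFactor, bit, hA, hB, not_true, not_false_iff,
        if_true, if_false] <;>
      norm_num [hmarked, h0, h1, hstrip] <;> ring

end markedSum

/-- Whether the cells of the skew shape `A / B` may carry a common letter: a marked one if `M` is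
even, an unmarked one if `M` is odd. -/
structure IsStrip (M : ℕ) (B A : Finset ℕ) : Prop where
  le : ∀ p, diagLen B p ≤ diagLen A p
  row : M % 2 = 0 → ∀ p, diagLen A (p + 1) ≤ diagLen B p
  col : M % 2 = 1 → ∀ p, diagLen A p ≤ diagLen B (p + 1) + 1
  diag : M % 2 = 0 → diagLen A 0 ≤ diagLen B 0

theorem edgeFactor_ite (q : Prop) [Decidable q] (x : R) (a b : ℕ) :
    edgeFactor (if q then x else 0) ((a : ℤ) - b) =
      if b ≤ a ∧ a ≤ b + (if q then 1 else 0) then x ^ (a - b) else 0 := by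
  by_cases h0 : a = b
  · simp [edgeFactor, h0]
  by_cases h1 : a = b + 1
  · by_cases hq : q <;> simp [edgeFactor, h1, hq]
  · rw [edgeFactor_eq_zero _ (by omega), if_neg]
    split_ifs <;> omega

section IsStrip

variable {B A : Finset ℕ} {L : ℕ}

open Classical in
theorem transferWeight_ite (hB : B ⊆ Finset.range L) (hA : A ⊆ Finset.range L) (q₀ : Bool)
    (q : Bool → Bool → Bool) (x : R) :
    transferWeight (if q₀ then x else 0) (fun b a => if q b a then x else 0) B A L 0 =
      if (∀ p, diagLen B p ≤ diagLen A p) ∧ diagLen A 0 ≤ diagLen B 0 + (if q₀ then 1 else 0) ∧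
          ∀ p, diagLen A (p + 1) ≤ diagLen B (p + 1) + if q (p ∈ B) (p ∈ A) then 1 else 0
        then x ^ (size A - size B) else 0 := by
  have hrange (C : Finset ℕ) (hC : C ⊆ Finset.range L) :
      size C = ∑ p ∈ Finset.range (L + 1), diagLen C p :=
    size_eq_sum_diagLen (hC.trans (Finset.range_subset_range.2 L.le_succ))
  have hzero (p : ℕ) (hp : L ≤ p) : diagLen A p = 0 ∧ diagLen B p = 0 :=
    ⟨diagLen_eq_zero hA hp, diagLen_eq_zero hB hp⟩
  rw [transferWeight_eq_prod _ _ hB hA]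
  simp only [edgeFactor_ite, Finset.prod_ite_zero, ite_zero_mul_ite_zero, Finset.mem_range]
  refine ite_congr (propext ⟨fun ⟨h0, h⟩ => ⟨fun p => ?_, h0.2, fun p => ?_⟩,
    fun h => ⟨⟨h.1 0, h.2.1⟩, fun p _ => ⟨h.1 _, h.2.2 p⟩⟩⟩) (fun h => ?_) fun _ => rfl
  · cases p with
    | zero => exact h0.1
    | succ p =>
      by_cases hp : p < L
      · exact (h p hp).1
      · simp [hzero (p + 1) (by omega)]
  · by_cases hp : p < L
    · exact (h p hp).2
    · simp [hzero (p + 1) (by omega)]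
  · rw [hrange A hA, hrange B hB, ← Finset.sum_tsub_distrib _ fun p _ => h.1 p,
      Finset.sum_range_succ', pow_add, Finset.prod_pow_eq_pow_sum, mul_comm]

open Classical in
theorem vertWeight_eq_ite (x : R) {M : ℕ} (hM : M % 2 = 0) (hB : B ⊆ Finset.range L)
    (hA : A ⊆ Finset.range L) :
    vertWeight x B A L 0 = if IsStrip M B A then x ^ (size A - size B) else 0 := by
  have h := transferWeight_ite hB hA false (fun b _ => b) x
  simp only [Bool.false_eq_true, if_false, decide_eq_true_eq, ← diagLen_eq_add_ite, add_zero] at h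
  rw [vertWeight, h]
  exact ite_congr (propext ⟨fun h => ⟨h.1, fun _ => h.2.2, by omega, fun _ => h.2.1⟩,
    fun h => ⟨h.le, h.diag hM, h.row hM⟩⟩) (fun _ => rfl) fun _ => rfl

open Classical in
theorem horizWeight_eq_ite (x : R) {M : ℕ} (hM : M % 2 = 1) (hB : B ⊆ Finset.range L)
    (hA : A ⊆ Finset.range L) :
    horizWeight x B A L 0 = if IsStrip M B A then x ^ (size A - size B) else 0 := by
  have h := transferWeight_ite hB hA true (fun _ a => !a) x
  simp only [if_true] at h
  rw [horizWeight, h]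
  have hcol (p : ℕ) : (diagLen A (p + 1) ≤ diagLen B (p + 1) + if !decide (p ∈ A) then 1 else 0) ↔
      diagLen A p ≤ diagLen B (p + 1) + 1 := by
    rw [diagLen_eq_add_ite A p]
    by_cases hp : p ∈ A <;> simp [hp]
  simp only [hcol]
  refine ite_congr (propext ⟨fun h => ⟨h.1, by omega, fun _ => h.2.2, by omega⟩,
    fun h => ⟨h.le, ?_, h.col hM⟩⟩) (fun _ => rfl) fun _ => rfl
  exact (h.col hM 0).trans (by rw [diagLen_eq_add_ite B 0]; omega)

end IsStrip

/-! ### Tableaux as chains of strips -/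

/-- `T` is a marked shifted tableau of shape `A`, without marked letters on the main diagonal, in
the first `M` letters: `T i p` is the index of the letter in row `i` on the diagonal of content
`p`, and `M` outside of the shape. The odd indices belong to the unmarked letters. -/
structure IsTableau (M : ℕ) (A : Finset ℕ) (T : ℕ → ℕ → ℕ) : Prop where
  le : ∀ i p, T i p ≤ M
  lt_iff : ∀ i p, T i p < M ↔ i < diagLen A p
  row_le : ∀ i p, T i p ≤ T i (p + 1)
  col_le : ∀ i p, T i (p + 1) ≤ T (i + 1) p
  row_odd : ∀ i p, T i p < M → T i p = T i (p + 1) → T i p % 2 = 1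
  col_even : ∀ i p, T i (p + 1) < M → T i (p + 1) = T (i + 1) p → T i (p + 1) % 2 = 0
  diag_odd : ∀ i, T i 0 < M → T i 0 % 2 = 1

/-- The type of marked shifted tableaux of shape `A` in the first `M` letters. -/
def Tableau (M : ℕ) (A : Finset ℕ) : Type := {T : ℕ → ℕ → ℕ // IsTableau M A T}

/-- Add the letter of index `M` in the cells of `A` not yet filled by the tableau `T` in the first
`M` letters. -/
def addLetter (M : ℕ) (A : Finset ℕ) (T : ℕ → ℕ → ℕ) (i p : ℕ) : ℕ :=
  if T i p < M then T i p else if i < diagLen A p then M else M + 1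

namespace IsTableau

variable {M M' L : ℕ} {A B : Finset ℕ} {T : ℕ → ℕ → ℕ}

theorem succ_of_isStrip (hT : IsTableau M B T) (h : IsStrip M B A) :
    IsTableau (M + 1) A (addLetter M A T) := by
  have hlt := hT.lt_iff
  have hBA (i p : ℕ) : T i p < M → i < diagLen A p := fun hi =>
    ((hlt i p).1 hi).trans_le (h.le p)
  constructor <;> intro i <;> unfold addLetter
  · grind
  · grind
  · intro p
    have := diagLen_succ_le A p
    have := hT.row_le i p
    grind
  · intro p
    have := diagLen_le_succ_add_one A p
    have := hT.col_le i p
    grind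
  · intro p
    have := hT.row_le i p
    have := hT.row_odd i p
    have := h.row
    grind
  · intro p
    have := hT.col_le i p
    have := hT.col_even i p
    have := h.col
    grind
  · have := hT.diag_odd i
    have := h.diag
    grind

theorem min_addLetter (hT : IsTableau M B T) (i p : ℕ) :
    min (addLetter M A T i p) M = T i p := by
  have := hT.le i p
  unfold addLetter
  split_ifs <;> omega

theorem addLetter_min (hT : IsTableau (M + 1) A T) :
    addLetter M A (fun i p => min (T i p) M) = T := by
  funext i p
  have := hT.le i p
  have := hT.lt_iff i p
  simp only [addLetter]
  split_ifs <;> omega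

theorem shape_unique (hT : IsTableau M A T) (hT' : IsTableau M B T) : A = B := by
  refine diagLen_injective (funext fun p => eq_of_forall_lt_iff fun i => ?_)
  rw [← hT.lt_iff, ← hT'.lt_iff]

theorem exists_shape_lt (hT : IsTableau M A T) (hA : A ⊆ Finset.range L) (hM : M' ≤ M) :
    ∃ B ⊆ Finset.range L, ∀ i p, T i p < M' ↔ i < diagLen B p := by
  have hcol (p : ℕ) : Monotone fun i => T i p :=
    monotone_nat_of_le_succ fun i => (hT.row_le i p).trans (hT.col_le i p)
  have hex (p : ℕ) : ∃ i, M' ≤ T i p :=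
    ⟨diagLen A p, hM.trans (not_lt.1 ((hT.lt_iff _ p).not.2 (lt_irrefl _)))⟩
  let c (p : ℕ) : ℕ := Nat.find (hex p)
  have hc (i p : ℕ) : T i p < M' ↔ i < c p := by
    refine ⟨fun hi => ?_, fun hi => not_le.1 (Nat.find_min (hex p) hi)⟩
    by_contra hlt
    exact hi.not_ge ((Nat.find_spec (hex p)).trans (hcol p (not_lt.1 hlt)))
  obtain ⟨B, hBL, hB⟩ := exists_diagLen_eq (L := L) c
    (fun p hp => by
      rw [← Nat.le_zero, ← diagLen_eq_zero hA hp]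
      exact le_of_forall_lt fun i hi => (hT.lt_iff i p).1 (((hc i p).2 hi).trans_le hM))
    (fun p => le_of_forall_lt fun i hi =>
      (hc i p).1 ((hT.row_le i p).trans_lt ((hc i (p + 1)).2 hi)))
    (fun p => Nat.sub_le_iff_le_add.1 (le_of_forall_lt fun i hi =>
      (hc i (p + 1)).1 ((hT.col_le i p).trans_lt ((hc (i + 1) p).2 (by omega)))))
  exact ⟨B, hBL, fun i p => by rw [hc, hB]⟩

protected theorem min (hT : IsTableau M A T) (hM : M' ≤ M)
    (hB : ∀ i p, T i p < M' ↔ i < diagLen B p) : IsTableau M' B fun i p => min (T i p) M' where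
  le _ _ := min_le_right _ _
  lt_iff i p := by
    rw [← hB]
    omega
  row_le i p := min_le_min_right _ (hT.row_le i p)
  col_le i p := min_le_min_right _ (hT.col_le i p)
  row_odd i p _ _ := by
    have := hT.row_odd i p
    omega
  col_even i p _ _ := by
    have := hT.col_even i p
    omega
  diag_odd i _ := by
    have := hT.diag_odd i
    omega

theorem isStrip (hT : IsTableau (M + 1) A T) (hB : ∀ i p, T i p < M ↔ i < diagLen B p) :
    IsStrip M B A where
  le p := le_of_forall_lt fun i hi => by
    rw [← hB] at hi
    rw [← hT.lt_iff]
    omega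
  row hM p := le_of_forall_lt fun i hi => by
    rw [← hT.lt_iff] at hi
    rw [← hB]
    have := hT.row_le i p
    have := hT.row_odd i p
    omega
  col hM p := Nat.sub_le_iff_le_add.1 (le_of_forall_lt fun i hi => by
    have hi' := (hT.lt_iff (i + 1) p).2 (by omega)
    rw [← hB]
    have := hT.col_le i p
    have := hT.col_even i p
    omega)
  diag hM := le_of_forall_lt fun i hi => by
    rw [← hT.lt_iff] at hi
    rw [← hB]
    have := hT.diag_odd i
    omega

theorem zero_iff : IsTableau 0 A T ↔ A = ∅ ∧ T = fun _ _ => 0 := by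
  refine ⟨fun h => ⟨diagLen_injective (funext fun p => ?_), ?_⟩, ?_⟩
  · simpa [diagLen] using h.lt_iff 0 p
  · funext i p
    exact Nat.le_zero.1 (h.le i p)
  · rintro ⟨rfl, rfl⟩
    constructor <;> simp [diagLen]

end IsTableau

/-- Extend a tableau in the first `M` letters to a tableau of shape `A`, by adding a strip that is
filled with the letter of index `M`. -/
def addStrip (M L : ℕ) (A : Finset ℕ)
    (T : Σ B : {B : Shape L // IsStrip M B A}, Tableau M B.1) : Tableau (M + 1) A :=
  ⟨addLetter M A T.2.1, T.2.2.succ_of_isStrip T.1.2⟩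

theorem addStrip_bijective (M : ℕ) {L : ℕ} {A : Finset ℕ} (hA : A ⊆ Finset.range L) :
    Function.Bijective (addStrip M L A) := by
  constructor
  · rintro ⟨⟨⟨B, hBL⟩, hB⟩, T, hT⟩ ⟨⟨⟨B', hBL'⟩, hB'⟩, T', hT'⟩ h
    have hext : addLetter M A T = addLetter M A T' := congrArg Subtype.val h
    obtain rfl : T = T' := by
      funext i p
      rw [← hT.min_addLetter (A := A), ← hT'.min_addLetter (A := A), hext]
    obtain rfl := hT.shape_unique hT'
    rfl
  · rintro ⟨T, hT⟩
    obtain ⟨B, hBL, hB⟩ := hT.exists_shape_lt hA M.le_succ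
    exact ⟨⟨⟨⟨B, Finset.mem_powerset.2 hBL⟩, hT.isStrip hB⟩, _, hT.min M.le_succ hB⟩,
      Subtype.ext hT.addLetter_min⟩

instance (M : ℕ) (A : Finset ℕ) : Finite (Tableau M A) := by
  induction M generalizing A with
  | zero =>
    have : Subsingleton (Tableau 0 A) := ⟨fun T T' => Subtype.ext
      ((IsTableau.zero_iff.1 T.2).2.trans (IsTableau.zero_iff.1 T'.2).2.symm)⟩
    infer_instance
  | succ M ih => exact Finite.of_surjective _ (addStrip_bijective M A.subset_range_sup_succ).2

instance (M : ℕ) (A : Finset ℕ) : Fintype (Tableau M A) := Fintype.ofFinite _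

/-- The monomial `x^T` of a tableau `T` of a shape `A ⊆ {0, …, L - 1}`. -/
def tableauWeight (x : ℕ → R) (L M : ℕ) (A : Finset ℕ) (T : Tableau M A) : R :=
  ∏ p ∈ Finset.range L, ∏ i ∈ Finset.range (diagLen A p), x (T.1 i p / 2)

/-- The generating function of the tableaux of shape `A` in the first `M` letters. -/
def tableauSum (x : ℕ → R) (L M : ℕ) (A : Finset ℕ) : R := ∑ T, tableauWeight x L M A T

section tableauSum

variable (x : ℕ → R) (M N : ℕ) {L : ℕ} {A : Finset ℕ}

theorem tableauWeight_addStrip (hA : A ⊆ Finset.range L)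
    (T : Σ B : {B : Shape L // IsStrip M B A}, Tableau M B.1) :
    tableauWeight x L (M + 1) A (addStrip M L A T) =
      x (M / 2) ^ (size A - size T.1.1) * tableauWeight x L M T.1.1 T.2 := by
  obtain ⟨⟨B, hB⟩, T, hT⟩ := T
  rw [size_eq_sum_diagLen hA, size_eq_sum_diagLen B.subset,
    ← Finset.sum_tsub_distrib _ fun p _ => hB.le p, ← Finset.prod_pow_eq_pow_sum]
  simp only [tableauWeight, addStrip, ← Finset.prod_mul_distrib]
  refine Finset.prod_congr rfl fun p _ => ?_
  rw [← Finset.prod_range_mul_prod_Ico _ (hB.le p), mul_comm]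
  congr 1
  · rw [← Nat.card_Ico, ← Finset.prod_const]
    refine Finset.prod_congr rfl fun i hi => ?_
    rw [Finset.mem_Ico] at hi
    rw [addLetter, if_neg ((hT.lt_iff _ _).not.2 (not_lt.2 hi.1)), if_pos hi.2]
  · refine Finset.prod_congr rfl fun i hi => ?_
    rw [addLetter, if_pos (by rwa [hT.lt_iff, ← Finset.mem_range])]

open Classical in
theorem tableauSum_succ (hA : A ⊆ Finset.range L) :
    tableauSum x L (M + 1) A =
      ∑ B : Shape L, (if IsStrip M B A then x (M / 2) ^ (size A - size B) else 0) *
        tableauSum x L M B := by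
  simp only [ite_mul, zero_mul]
  rw [tableauSum, ← (addStrip_bijective M hA).sum_comp, Fintype.sum_sigma,
    ← Finset.sum_filter, Finset.sum_subtype (F := Subtype.fintype fun B : Shape L => IsStrip M B A)
      _ fun B => Finset.mem_filter_univ B]
  simp only [tableauWeight_addStrip x M hA, ← Finset.mul_sum, tableauSum]

theorem tableauSum_zero (A : Shape L) :
    tableauSum x L 0 A = (Pi.single (Shape.empty L) 1 : Shape L → R) A := by
  rcases eq_or_ne A (Shape.empty L) with rfl | hA
  · let _ : Unique (Tableau 0 (Shape.empty L)) :=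
      { default := ⟨fun _ _ => 0, IsTableau.zero_iff.2 ⟨rfl, rfl⟩⟩
        uniq T := Subtype.ext (IsTableau.zero_iff.1 T.2).2 }
    rw [tableauSum, Fintype.sum_unique, tableauWeight]
    simp [diagLen, Shape.empty]
  · have : IsEmpty (Tableau 0 A.1) :=
      ⟨fun T => hA (Shape.val_eq_empty_iff.1 (IsTableau.zero_iff.1 T.2).1)⟩
    simp [tableauSum, hA]

theorem tableauSum_two_mul_succ (hA : A ⊆ Finset.range L) :
    tableauSum x L (2 * (N + 1)) A =
      ∑ B : Shape L, tableauSum x L (2 * N) B * stripWeight 1 (x N) B A L 0 := by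
  have hvert (C : Shape L) : tableauSum x L (2 * N + 1) C =
      ∑ B : Shape L, vertWeight (x N) B C L 0 * tableauSum x L (2 * N) B := by
    rw [tableauSum_succ x _ C.subset, Nat.mul_div_cancel_left N two_pos]
    exact Finset.sum_congr rfl fun B _ => by
      rw [vertWeight_eq_ite _ (Nat.mul_mod_right 2 N) B.subset C.subset]
  have hhoriz : tableauSum x L (2 * N + 1 + 1) A =
      ∑ C : Shape L, horizWeight (x N) C A L 0 * tableauSum x L (2 * N + 1) C := by
    rw [tableauSum_succ x _ hA, show (2 * N + 1) / 2 = N by omega]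
    exact Finset.sum_congr rfl fun C _ => by
      rw [horizWeight_eq_ite (M := 2 * N + 1) _ (by omega) C.subset hA]
  rw [show 2 * (N + 1) = 2 * N + 1 + 1 by ring, hhoriz]
  simp only [hvert, Finset.mul_sum]
  rw [Finset.sum_comm]
  have hmarked (B : Shape L) : stripWeight 1 (x N) B A L 0 =
      ∑ C : Shape L, vertWeight (x N) B C L 0 * horizWeight (x N) C A L 0 := by
    rw [(stripWeight_one_eq_markedSum (x N) B A L).1, markedSum]
    exact (Finset.sum_coe_sort _ _).symm
  simp only [hmarked, Finset.mul_sum]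
  exact Finset.sum_congr rfl fun B _ => Finset.sum_congr rfl fun C _ => by ring

theorem tableauSum_two_mul (A : Shape L) : tableauSum x L (2 * N) A = shiftedSchur 1 L x N A := by
  induction N generalizing A with
  | zero => rw [mul_zero, tableauSum_zero, shiftedSchur]
  | succ N ih =>
    rw [tableauSum_two_mul_succ x N A.subset, shiftedSchur_succ_apply]
    simp only [ih]

end tableauSum

/-! ### Schur's `P`-functions -/

section shape

variable {n : ℕ} {lam : n.Partition}

/-- The encoding of a partition of `n` with distinct parts as a set of natural numbers. -/
def shape (lam : n.Partition) : Shape n :=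
  ⟨lam.parts.toFinset.image (· - 1), Finset.mem_powerset.2 fun a ha => by
    obtain ⟨b, hb, rfl⟩ := Finset.mem_image.1 ha
    have hpos := lam.parts_pos (Multiset.mem_toFinset.1 hb)
    have hle := Nat.Partition.le_of_mem_parts (Multiset.mem_toFinset.1 hb)
    exact Finset.mem_range.2 (by omega)⟩

theorem mem_shape {a : ℕ} : a ∈ (shape lam).1 ↔ a + 1 ∈ lam.parts := by
  simp only [shape, Finset.mem_image, Multiset.mem_toFinset]
  constructor
  · rintro ⟨b, hb, rfl⟩
    rwa [Nat.sub_add_cancel (lam.parts_pos hb)]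
  · exact fun h => ⟨a + 1, h, rfl⟩

theorem shape_injOn : Set.InjOn shape (Nat.Partition.distincts n : Set n.Partition) := by
  intro lam h lam' h' heq
  have hnd : lam.parts.Nodup := (Finset.mem_filter.1 h).2
  have hnd' : lam'.parts.Nodup := (Finset.mem_filter.1 h').2
  refine Nat.Partition.ext ((hnd.ext hnd').2 fun a => ?_)
  cases a with
  | zero => exact iff_of_false (fun h0 => (lam.parts_pos h0).ne rfl) fun h0 =>
      (lam'.parts_pos h0).ne rfl
  | succ a => rw [← mem_shape, ← mem_shape, heq]

theorem exists_shape_eq {A : Shape n} (hA : size A.1 = n) :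
    ∃ lam ∈ Nat.Partition.distincts n, shape lam = A := by
  refine ⟨⟨A.1.val.map (· + 1), fun {i} hi => ?_, hA⟩, ?_, ?_⟩
  · obtain ⟨a, -, rfl⟩ := Multiset.mem_map.1 hi
    exact a.succ_pos
  · exact Finset.mem_filter.2 ⟨Finset.mem_univ _, A.1.nodup.map (add_left_injective 1)⟩
  · ext a
    simp [mem_shape]

variable (h : lam ∈ Nat.Partition.distincts n)

include h

theorem sum_shape {M : Type*} [AddCommMonoid M] (f : ℕ → M) :
    ∑ a ∈ (shape lam).1, f (a + 1) = (lam.parts.map f).sum := by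
  have hnd : lam.parts.Nodup := (Finset.mem_filter.1 h).2
  have hpos {a : ℕ} (ha : a ∈ lam.parts.toFinset) : 1 ≤ a :=
    lam.parts_pos (Multiset.mem_toFinset.1 ha)
  rw [shape, Finset.sum_image fun a ha b hb => (tsub_left_inj (hpos ha) (hpos hb)).1,
    Finset.sum_congr rfl fun a ha => by rw [Nat.sub_add_cancel (hpos ha)], Finset.sum,
    Multiset.toFinset_val, hnd.dedup]

theorem size_shape : size (shape lam) = n := by
  rw [size, sum_shape h fun a => a, Multiset.map_id', lam.parts_sum]

theorem card_shape : (shape lam).1.card = lam.parts.card := by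
  rw [Finset.card_eq_sum_ones, sum_shape h fun _ => 1, Multiset.map_const', Multiset.sum_replicate,
    smul_eq_mul, mul_one]

theorem diagLen_shape (p : ℕ) : diagLen (shape lam) p = lam.parts.countP (p < ·) := by
  simp only [diagLen, Finset.card_filter, ← Nat.lt_succ_iff]
  rw [sum_shape h fun a => if p < a then 1 else 0]
  induction lam.parts using Multiset.induction_on with
  | empty => rfl
  | cons a s ih => rw [Multiset.map_cons, Multiset.sum_cons, Multiset.countP_cons, ih, add_comm]

end shape

theorem sum_distincts {M : Type*} [AddCommMonoid M] (n : ℕ) (f : Shape n → M) :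
    ∑ lam ∈ Nat.Partition.distincts n, f (shape lam) = ∑ A : Shape n with size A.1 = n, f A :=
  Finset.sum_nbij shape (fun _ h => Finset.mem_filter.2 ⟨Finset.mem_univ _, size_shape h⟩)
    shape_injOn (fun _ hA => exists_shape_eq (Finset.mem_filter.1 hA).2) fun _ _ => rfl

theorem lt_getD_iff_lt_countP {l : List ℕ} (hl : l.Pairwise (· ≥ ·)) (i p : ℕ) :
    p < l.getD i 0 ↔ i < l.countP (p < ·) := by
  induction l generalizing i with
  | nil => simp
  | cons a l ih =>
    rw [List.pairwise_cons] at hl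
    by_cases ha : p < a
    · rw [List.countP_cons_of_pos (by simpa using ha)]
      cases i with
      | zero => simpa using ha
      | succ i => simpa using ih hl.2 i
    · have hzero : l.countP (p < ·) = 0 :=
        List.countP_eq_zero.2 fun b hb => by simpa using (hl.1 b hb).trans (not_lt.1 ha)
      rw [List.countP_cons_of_neg (by simpa using ha), hzero]
      cases i with
      | zero => simpa using ha
      | succ i => simpa [hzero] using ih hl.2 i

section shiftedDiagram

variable {n : ℕ} {lam : n.Partition} (h : lam ∈ Nat.Partition.distincts n)

include h

theorem lt_rowLen_iff (i p : ℕ) : p < rowLen lam i ↔ i < diagLen (shape lam) p := by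
  rw [rowLen, lt_getD_iff_lt_countP (Multiset.pairwise_sort _ _), diagLen_shape h,
    ← Multiset.coe_countP, Multiset.sort_eq]

theorem mem_shiftedDiagram {i j : ℕ} :
    (i, j) ∈ shiftedDiagram lam ↔ i ≤ j ∧ i < diagLen (shape lam) (j - i) := by
  simp only [shiftedDiagram, Finset.mem_biUnion, Finset.mem_range, Finset.mem_product,
    Finset.mem_singleton, Finset.mem_Ico]
  rw [← lt_rowLen_iff h]
  refine ⟨fun ⟨k, _, hk, hij⟩ => by subst hk; omega, fun ⟨hij, hlt⟩ => ⟨i, ?_, rfl, hij, by omega⟩⟩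
  by_contra hi
  rw [rowLen, List.getD_eq_default _ _ (by simpa using hi)] at hlt
  exact Nat.not_lt_zero _ hlt

theorem mk_add_mem_shiftedDiagram {i p : ℕ} :
    (i, i + p) ∈ shiftedDiagram lam ↔ i < diagLen (shape lam) p := by
  simp [mem_shiftedDiagram h]

theorem left_mem_shiftedDiagram {i p : ℕ} (hip : (i, i + (p + 1)) ∈ shiftedDiagram lam) :
    (i, i + p) ∈ shiftedDiagram lam := by
  rw [mk_add_mem_shiftedDiagram h] at hip ⊢
  exact hip.trans_le (diagLen_succ_le _ _)

theorem above_mem_shiftedDiagram {i p : ℕ} (hip : (i + 1, i + 1 + p) ∈ shiftedDiagram lam) :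
    (i, i + (p + 1)) ∈ shiftedDiagram lam := by
  rw [mk_add_mem_shiftedDiagram h] at hip ⊢
  have := diagLen_le_succ_add_one (shape lam) p
  omega

end shiftedDiagram

/-- The order isomorphism that sends the letters `0' < 0 < 1' < 1 < ⋯` to `0 < 1 < 2 < 3 < ⋯`. -/
def Letter.index : Letter ≃o ℕ where
  toFun a := 2 * a.abs + if (ofLex a).2 then 1 else 0
  invFun k := toLex (k / 2, decide (k % 2 = 1))
  left_inv a := by
    obtain ⟨⟨k, b⟩, rfl⟩ := toLex.surjective a
    cases b
    · simp [abs]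
    · simp only [abs, ofLex_toLex, if_true, toLex_inj, Prod.mk.injEq, decide_eq_true_eq]
      omega
  right_inv k := by
    simp only [abs, ofLex_toLex, decide_eq_true_eq]
    split_ifs <;> omega
  map_rel_iff' {a b} := by
    rw [Prod.Lex.le_iff, Equiv.coe_fn_mk, abs, abs]
    cases ha : (ofLex a).2 <;> cases hb : (ofLex b).2 <;> simp <;> omega

theorem Letter.abs_eq_index_div (a : Letter) : a.abs = index a / 2 := by
  change a.abs = (2 * a.abs + if (ofLex a).2 then 1 else 0) / 2
  split_ifs <;> omega

theorem Letter.marked_iff (a : Letter) : a.Marked ↔ index a % 2 = 0 := by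
  change (ofLex a).2 = false ↔ (2 * a.abs + if (ofLex a).2 then 1 else 0) % 2 = 0
  cases (ofLex a).2 <;> simp

attribute [ext] MarkedShiftedTableau

namespace MarkedShiftedTableau

variable {n N : ℕ} {lam : n.Partition} (T : MarkedShiftedTableau lam)

open Classical in
/-- The indices of the letters of a marked shifted tableau, by row and content, and `2 * N` outside
of the shape. -/
def toIndex (N i p : ℕ) : ℕ :=
  if h : (i, i + p) ∈ shiftedDiagram lam then Letter.index (T.entry ⟨(i, i + p), h⟩) else 2 * N

theorem toIndex_of_mem {i p : ℕ} (h : (i, i + p) ∈ shiftedDiagram lam) :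
    T.toIndex N i p = Letter.index (T.entry ⟨(i, i + p), h⟩) := dif_pos h

theorem toIndex_of_notMem {i p : ℕ} (h : (i, i + p) ∉ shiftedDiagram lam) :
    T.toIndex N i p = 2 * N := dif_neg h

theorem toIndex_lt_iff (hT : ∀ c, (T.entry c).abs < N) {i p : ℕ} :
    T.toIndex N i p < 2 * N ↔ (i, i + p) ∈ shiftedDiagram lam := by
  by_cases h : (i, i + p) ∈ shiftedDiagram lam
  · have := hT ⟨_, h⟩
    rw [Letter.abs_eq_index_div] at this
    simp only [T.toIndex_of_mem h, h, iff_true]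
    omega
  · simp [T.toIndex_of_notMem h, h]

theorem toIndex_le (hT : ∀ c, (T.entry c).abs < N) (i p : ℕ) : T.toIndex N i p ≤ 2 * N := by
  by_cases h : (i, i + p) ∈ shiftedDiagram lam
  · exact ((T.toIndex_lt_iff hT).2 h).le
  · exact (T.toIndex_of_notMem h).le

theorem isTableau_toIndex (h : lam ∈ Nat.Partition.distincts n) (hT : ∀ c, (T.entry c).abs < N) :
    IsTableau (2 * N) (shape lam) (T.toIndex N) where
  le := T.toIndex_le hT
  lt_iff i p := (T.toIndex_lt_iff hT).trans (mk_add_mem_shiftedDiagram h)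
  row_le i p := by
    by_cases hip : (i, i + (p + 1)) ∈ shiftedDiagram lam
    · rw [T.toIndex_of_mem hip, T.toIndex_of_mem (left_mem_shiftedDiagram h hip),
        Letter.index.le_iff_le]
      exact T.row_le _ _ rfl (by simp)
    · rw [T.toIndex_of_notMem hip]
      exact T.toIndex_le hT _ _
  col_le i p := by
    by_cases hip : (i + 1, i + 1 + p) ∈ shiftedDiagram lam
    · rw [T.toIndex_of_mem hip, T.toIndex_of_mem (above_mem_shiftedDiagram h hip),
        Letter.index.le_iff_le]
      exact T.col_le _ _ (by simp only; omega) (by simp)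
    · rw [T.toIndex_of_notMem hip]
      exact T.toIndex_le hT _ _
  row_odd i p hlt heq := by
    have hip := (T.toIndex_lt_iff hT).1 (heq ▸ hlt)
    have hleft := left_mem_shiftedDiagram h hip
    rw [T.toIndex_of_mem hip, T.toIndex_of_mem hleft] at heq
    rw [T.toIndex_of_mem hleft, ← Nat.mod_two_ne_zero, Ne, ← Letter.marked_iff]
    exact T.row_marked ⟨_, hleft⟩ ⟨_, hip⟩ rfl (by simp) (Letter.index.injective heq)
  col_even i p hlt heq := by
    have hip := (T.toIndex_lt_iff hT).1 (heq ▸ hlt)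
    have habove := above_mem_shiftedDiagram h hip
    rw [T.toIndex_of_mem hip, T.toIndex_of_mem habove] at heq
    rw [T.toIndex_of_mem habove, ← Letter.marked_iff]
    exact T.col_unmarked ⟨_, habove⟩ ⟨_, hip⟩ (by simp only; omega) (by simp)
      (Letter.index.injective heq)
  diag_odd i hlt := by
    have hi := (T.toIndex_lt_iff hT).1 hlt
    rw [T.toIndex_of_mem hi, ← Nat.mod_two_ne_zero, Ne, ← Letter.marked_iff]
    exact T.diag_unmarked ⟨_, hi⟩ rfl

theorem abs_lt_iff_weight_eq_zero :
    (∀ c, (T.entry c).abs < N) ↔ ∀ i, N ≤ i → T.weight i = 0 := by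
  simp only [weight, Finsupp.finsetSum_apply, Finset.sum_eq_zero_iff, Finset.mem_univ,
    forall_const, Finsupp.single_apply_eq_zero, one_ne_zero, imp_false]
  exact ⟨fun h i hi c hc => (h c).not_ge (hc ▸ hi), fun h c => not_le.1 fun hc => h _ hc c rfl⟩

end MarkedShiftedTableau

namespace IsTableau

variable {M : ℕ} {A : Finset ℕ} {T : ℕ → ℕ → ℕ} (hT : IsTableau M A T)

include hT

theorem row_monotone (i : ℕ) : Monotone (T i) := monotone_nat_of_le_succ (hT.row_le i)

theorem le_of_content_eq {i i' p p' : ℕ} (hi : i ≤ i') (hp : i + p = i' + p') :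
    T i p ≤ T i' p' := by
  induction i', hi using Nat.le_induction generalizing p' with
  | base => rw [Nat.add_left_cancel hp]
  | succ i' _ ih => exact (ih (p' := p' + 1) (by omega)).trans (hT.col_le i' p')

theorem odd_of_row_eq {i p p' : ℕ} (hp : p < p') (hlt : T i p < M) (heq : T i p = T i p') :
    T i p % 2 = 1 :=
  hT.row_odd i p hlt ((hT.row_le i p).antisymm (heq ▸ hT.row_monotone i hp))

theorem even_of_col_eq {i i' p p' : ℕ} (hi : i < i') (hp : i + p = i' + p') (hlt : T i p < M)
    (heq : T i p = T i' p') : T i p % 2 = 0 := by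
  obtain ⟨q, rfl⟩ : ∃ q, p = q + 1 := ⟨p - 1, by omega⟩
  exact hT.col_even i q hlt ((hT.col_le i q).antisymm
    (heq ▸ hT.le_of_content_eq hi (by omega)))

end IsTableau

section schurP

variable {n : ℕ} {lam : n.Partition} (h : lam ∈ Nat.Partition.distincts n) (N : ℕ)

/-- The marked shifted tableau whose letters have the indices given by `T`. -/
def Tableau.toMarked {N : ℕ} (T : Tableau (2 * N) (shape lam)) : MarkedShiftedTableau lam where
  entry c := Letter.index.symm (T.1 c.1.1 (c.1.2 - c.1.1))
  row_le := by
    rintro ⟨⟨i, j⟩, hc⟩ ⟨⟨_, j'⟩, hd⟩ rfl hj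
    exact Letter.index.symm.monotone (T.2.row_monotone i (Nat.sub_le_sub_right hj i))
  col_le := by
    rintro ⟨⟨i, j⟩, hc⟩ ⟨⟨i', _⟩, hd⟩ rfl (hi : i ≤ i')
    have hij : i ≤ j := ((mem_shiftedDiagram h).1 hc).1
    have hij' : i' ≤ j := ((mem_shiftedDiagram h).1 hd).1
    have hcontent : i + (j - i) = i' + (j - i') := by omega
    exact Letter.index.symm.monotone (T.2.le_of_content_eq hi hcontent)
  row_marked := by
    rintro ⟨⟨i, j⟩, hc⟩ ⟨⟨_, j'⟩, hd⟩ rfl (hj : j < j') heq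
    obtain ⟨hij, hlt⟩ := (mem_shiftedDiagram h).1 hc
    have hodd := T.2.odd_of_row_eq (Nat.sub_lt_sub_right hij hj) ((T.2.lt_iff _ _).2 hlt)
      (Letter.index.symm.injective heq)
    rw [Letter.marked_iff, OrderIso.apply_symm_apply]
    exact Nat.mod_two_ne_zero.2 hodd
  col_unmarked := by
    rintro ⟨⟨i, j⟩, hc⟩ ⟨⟨i', _⟩, hd⟩ rfl (hi : i < i') heq
    obtain ⟨hij, hlt⟩ : i ≤ j ∧ i < diagLen (shape lam) (j - i) := (mem_shiftedDiagram h).1 hc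
    have hij' : i' ≤ j := ((mem_shiftedDiagram h).1 hd).1
    have hcontent : i + (j - i) = i' + (j - i') := by omega
    rw [Letter.marked_iff, OrderIso.apply_symm_apply]
    exact T.2.even_of_col_eq hi hcontent ((T.2.lt_iff _ _).2 hlt) (Letter.index.symm.injective heq)
  diag_unmarked := by
    rintro ⟨⟨i, j⟩, hc⟩ (rfl : i = j)
    have hlt : i < diagLen (shape lam) (i - i) := ((mem_shiftedDiagram h).1 hc).2
    rw [Nat.sub_self] at hlt
    have hodd := T.2.diag_odd i ((T.2.lt_iff i 0).2 hlt)
    rw [Letter.marked_iff, OrderIso.apply_symm_apply]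
    change ¬T.1 i (i - i) % 2 = 0
    rw [Nat.sub_self]
    exact Nat.mod_two_ne_zero.2 hodd

/-- Tableaux in the first `2 * N` letters are marked shifted tableaux in the letters of absolute
value less than `N`. -/
def tableauEquiv :
    Tableau (2 * N) (shape lam) ≃ {T : MarkedShiftedTableau lam // ∀ c, (T.entry c).abs < N} where
  toFun T := ⟨T.toMarked h, fun c => by
    have hlt := (T.2.lt_iff _ _).2 ((mem_shiftedDiagram h).1 c.2).2
    rw [Letter.abs_eq_index_div, Tableau.toMarked, OrderIso.apply_symm_apply]
    exact Nat.div_lt_of_lt_mul hlt⟩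
  invFun T := ⟨T.1.toIndex N, T.1.isTableau_toIndex h T.2⟩
  left_inv T := by
    refine Subtype.ext (funext₂ fun i p => ?_)
    by_cases hip : (i, i + p) ∈ shiftedDiagram lam
    · simp [MarkedShiftedTableau.toIndex_of_mem _ hip, Tableau.toMarked]
    · refine (MarkedShiftedTableau.toIndex_of_notMem _ hip).trans ?_
      rw [mk_add_mem_shiftedDiagram h, ← T.2.lt_iff, not_lt] at hip
      exact hip.antisymm (T.2.le i p)
  right_inv T := by
    refine Subtype.ext (MarkedShiftedTableau.ext (funext fun ⟨⟨i, j⟩, hc⟩ => ?_))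
    obtain ⟨p, rfl⟩ := Nat.exists_eq_add_of_le ((mem_shiftedDiagram h).1 hc).1
    simp [Tableau.toMarked, MarkedShiftedTableau.toIndex_of_mem _ hc]

theorem tableauWeight_eq_prod (x : ℕ → R) (T : Tableau (2 * N) (shape lam)) :
    tableauWeight x n (2 * N) (shape lam) T = ∏ c, x ((tableauEquiv h N T).1.entry c).abs := by
  have hprod : ∏ c, x ((tableauEquiv h N T).1.entry c).abs =
      ∏ c ∈ shiftedDiagram lam, x (T.1 c.1 (c.2 - c.1) / 2) :=
    Finset.prod_coe_sort (shiftedDiagram lam) fun c => x (T.1 c.1 (c.2 - c.1) / 2)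
  rw [hprod, tableauWeight, Finset.prod_sigma']
  refine Finset.prod_bij' (fun q _ => (q.2, q.2 + q.1)) (fun c _ => ⟨c.2 - c.1, c.1⟩) ?_ ?_ ?_ ?_ ?_
  · rintro ⟨p, i⟩ hq
    simp only [Finset.mem_sigma, Finset.mem_range] at hq
    exact (mk_add_mem_shiftedDiagram h).2 hq.2
  · rintro ⟨i, j⟩ hc
    have hlt := ((mem_shiftedDiagram h).1 hc).2
    simp only [Finset.mem_sigma, Finset.mem_range]
    refine ⟨not_le.1 fun hle => ?_, hlt⟩
    rw [diagLen_eq_zero (shape lam).subset hle] at hlt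
    exact Nat.not_lt_zero _ hlt
  · simp
  · rintro ⟨i, j⟩ hc
    simp [((mem_shiftedDiagram h).1 hc).1]
  · simp

theorem tableauWeight_X (T : Tableau (2 * N) (shape lam)) :
    tableauWeight (fun i => (MvPowerSeries.X i : Series)) n (2 * N) (shape lam) T =
      MvPowerSeries.monomial (tableauEquiv h N T).1.weight 1 := by
  rw [tableauWeight_eq_prod h, MarkedShiftedTableau.weight]
  simp only [MvPowerSeries.X_def, MvPowerSeries.prod_monomial, Finset.prod_const_one]

variable {N} {d : ℕ →₀ ℕ}

include h

open Classical in
theorem coeff_schurP_eq_card (hd : ∀ i, N ≤ i → d i = 0) :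
    MvPowerSeries.coeff d (schurP lam) = ((Finset.univ.filter
      fun T : Tableau (2 * N) (shape lam) => (tableauEquiv h N T).1.weight = d).card : ℚ) := by
  rw [MvPowerSeries.coeff_apply, schurP, Nat.cast_inj, ← Fintype.card_subtype,
    ← Nat.card_eq_fintype_card]
  refine Nat.card_congr (Equiv.symm ?_)
  have hbounded {T : MarkedShiftedTableau lam} (hT : T.weight = d) : ∀ c, (T.entry c).abs < N :=
    T.abs_lt_iff_weight_eq_zero.2 (hT ▸ hd)
  exact ((tableauEquiv h N).subtypeEquiv (q := fun T => T.1.weight = d) fun _ => Iff.rfl).trans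
    (Equiv.subtypeSubtypeEquivSubtype hbounded)

theorem coeff_schurP (hd : ∀ i, N ≤ i → d i = 0) :
    MvPowerSeries.coeff d (schurP lam) = MvPowerSeries.coeff d
      (shiftedSchur 1 n (fun i => (MvPowerSeries.X i : Series)) N (shape lam)) := by
  classical
  rw [coeff_schurP_eq_card h hd, ← tableauSum_two_mul, tableauSum, map_sum, Finset.card_filter,
    Nat.cast_sum]
  refine Finset.sum_congr rfl fun T _ => ?_
  rw [tableauWeight_X h, MvPowerSeries.coeff_monomial]
  simp [eq_comm]

theorem evalOnes_schurP (m : ℕ) :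
    evalOnes m (schurP lam) = shiftedSchur 1 n (fun _ => (1 : ℚ)) m (shape lam) := by
  classical
  let w (T : Tableau (2 * m) (shape lam)) : ℕ →₀ ℕ := (tableauEquiv h m T).1.weight
  have hw (T) : ∀ i, m ≤ i → w T i = 0 :=
    (MarkedShiftedTableau.abs_lt_iff_weight_eq_zero _).1 (tableauEquiv h m T).2
  have hcard : evalOnes m (schurP lam) = (Fintype.card (Tableau (2 * m) (shape lam)) : ℚ) := by
    have hsum := finsum_mem_eq_sum_of_inter_support_eq (s := {d | ∀ i, m ≤ i → d i = 0})
      (t := Finset.univ.image w) (fun d => MvPowerSeries.coeff d (schurP lam)) (by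
        ext d
        simp only [Set.mem_inter_iff, Set.mem_ofPred_eq, Function.mem_support, Finset.coe_image,
          Finset.coe_univ, Set.image_univ, Set.mem_range]
        refine and_congr_left fun hne => ⟨fun hd => ?_, ?_⟩
        · rw [coeff_schurP_eq_card h hd, Nat.cast_ne_zero, Finset.card_ne_zero] at hne
          obtain ⟨T, hT⟩ := hne
          exact ⟨T, (Finset.mem_filter.1 hT).2⟩
        · rintro ⟨T, rfl⟩
          exact hw T)
    refine hsum.trans ?_
    rw [← Finset.card_univ, Finset.card_eq_sum_card_image w, Nat.cast_sum]
    refine Finset.sum_congr rfl fun d hd => ?_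
    obtain ⟨T, -, rfl⟩ := Finset.mem_image.1 hd
    exact coeff_schurP_eq_card h (hw T)
  rw [hcard, ← tableauSum_two_mul, tableauSum]
  simp [tableauWeight]

end schurP

/-! ### The cycle index of the symmetric group -/

/-- The order of the centralizer of a permutation with the cycle type `s` (fixed points included),
traditionally denoted by `z_s`. -/
def centralizerOrder (s : Multiset ℕ) : ℕ := s.prod * ∏ k ∈ s.toFinset, (s.count k).factorial

theorem centralizerOrder_cons (k : ℕ) (s : Multiset ℕ) :
    centralizerOrder (k ::ₘ s) = centralizerOrder s * (k * (s.count k + 1)) := by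
  have hsub : s.toFinset ⊆ (k ::ₘ s).toFinset :=
    Multiset.toFinset_subset.2 (Multiset.subset_cons s k)
  have hk : k ∈ (k ::ₘ s).toFinset := Multiset.mem_toFinset.2 (Multiset.mem_cons_self k s)
  have hprod : ∏ i ∈ s.toFinset, (s.count i).factorial =
      ∏ i ∈ (k ::ₘ s).toFinset, (s.count i).factorial :=
    Finset.prod_subset hsub fun i _ hi => by
      rw [Multiset.count_eq_zero_of_notMem (mt Multiset.mem_toFinset.2 hi), Nat.factorial_zero]
  rw [centralizerOrder, centralizerOrder, hprod, ← Finset.mul_prod_erase _ _ hk,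
    ← Finset.mul_prod_erase _ _ hk, Multiset.count_cons_self, Nat.factorial_succ,
    Multiset.prod_cons, Finset.prod_congr rfl fun i hi => by
      rw [Multiset.count_cons_of_ne (Finset.ne_of_mem_erase hi)]]
  ring

theorem centralizerOrder_ne_zero {s : Multiset ℕ} (h : 0 ∉ s) : centralizerOrder s ≠ 0 :=
  mul_ne_zero (Multiset.prod_ne_zero h)
    (Finset.prod_ne_zero_iff.2 fun _ _ => Nat.factorial_ne_zero _)

theorem centralizerOrder_add_replicate_one {s : Multiset ℕ} (hs : 1 ∉ s) (c : ℕ) :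
    centralizerOrder (s + Multiset.replicate c 1) = c.factorial * centralizerOrder s := by
  induction c with
  | zero => simp
  | succ c ih =>
    rw [Multiset.replicate_succ, Multiset.add_cons, centralizerOrder_cons, ih,
      Multiset.count_add, Multiset.count_eq_zero_of_notMem hs, Multiset.count_replicate_self,
      Nat.factorial_succ]
    ring

theorem parts_eq_filter_add_replicate_one {n : ℕ} (μ : n.Partition) :
    μ.parts = μ.parts.filter (2 ≤ ·) +
      Multiset.replicate (n - (μ.parts.filter (2 ≤ ·)).sum) 1 := by
  have hones : μ.parts.filter (¬2 ≤ ·) =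
      Multiset.replicate (Multiset.card (μ.parts.filter (¬2 ≤ ·))) 1 := by
    refine Multiset.eq_replicate_card.2 fun k hk => ?_
    have := μ.parts_pos (Multiset.mem_of_mem_filter hk)
    have := Multiset.of_mem_filter hk
    omega
  have hsplit := Multiset.filter_add_not (2 ≤ ·) μ.parts
  rw [hones] at hsplit
  have hsum := congrArg Multiset.sum hsplit
  rw [Multiset.sum_add, Multiset.sum_replicate, μ.parts_sum, smul_eq_mul, mul_one] at hsum
  rw [Nat.sub_eq_of_eq_add' hsum.symm, hsplit]

section permutations

variable {α : Type*} [Fintype α] [DecidableEq α]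

theorem partition_eq_iff (w : Equiv.Perm α) (μ : (Fintype.card α).Partition) :
    w.partition = μ ↔ w.cycleType = μ.parts.filter (2 ≤ ·) := by
  refine ⟨fun h => by rw [← h, Equiv.Perm.filter_parts_partition_eq_cycleType], fun h => ?_⟩
  rw [Nat.Partition.ext_iff, Equiv.Perm.parts_partition, ← Equiv.Perm.sum_cycleType, h,
    ← parts_eq_filter_add_replicate_one]

theorem card_partition_eq_mul_centralizerOrder (μ : (Fintype.card α).Partition) :
    (Finset.univ.filter fun w : Equiv.Perm α => w.partition = μ).card * centralizerOrder μ.parts =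
      (Fintype.card α).factorial := by
  have htwo : ∀ k ∈ μ.parts.filter (2 ≤ ·), 2 ≤ k := fun _ => Multiset.of_mem_filter
  have hle : (μ.parts.filter (2 ≤ ·)).sum ≤ Fintype.card α :=
    calc _ ≤ _ := Nat.le_add_right _ _
      _ = Fintype.card α := by rw [← Multiset.sum_add, Multiset.filter_add_not, μ.parts_sum]
  have hcard := Equiv.Perm.card_of_cycleType_mul_eq α (μ.parts.filter (2 ≤ ·))
  rw [if_pos ⟨hle, htwo⟩] at hcard
  rw [parts_eq_filter_add_replicate_one μ,
    centralizerOrder_add_replicate_one fun h => absurd (htwo 1 h) (by norm_num), ← hcard,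
    centralizerOrder, Finset.filter_congr fun w _ => partition_eq_iff w μ]
  ring

end permutations

section cycleIndex

variable {A : Type*} [CommRing A] [Algebra ℚ A] (a : ℕ → A)

/-- The cycle index of the symmetric group on `n` letters, with `a k` for the indeterminate that
records the cycles of length `k`. -/
def cycleIndex (n : ℕ) : A :=
  ∑ μ : n.Partition, ((centralizerOrder μ.parts : ℚ)⁻¹) • (μ.parts.map a).prod

variable {a} in
theorem cycleIndex_congr {b : ℕ → A} (h : ∀ k, 1 ≤ k → a k = b k) (n : ℕ) :
    cycleIndex a n = cycleIndex b n := by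
  rw [cycleIndex, cycleIndex]
  refine Finset.sum_congr rfl fun μ _ => ?_
  rw [Multiset.map_congr rfl fun k hk => h k (μ.parts_pos hk)]

theorem sum_perm_eq_cycleIndex (α : Type*) [Fintype α] [DecidableEq α] :
    (((Fintype.card α).factorial : ℚ)⁻¹) •
      ∑ w : Equiv.Perm α, (w.partition.parts.map a).prod = cycleIndex a (Fintype.card α) := by
  rw [cycleIndex, ← Finset.sum_fiberwise Finset.univ Equiv.Perm.partition, Finset.smul_sum]
  refine Finset.sum_congr rfl fun μ _ => ?_
  rw [Finset.sum_congr rfl fun w hw => by rw [(Finset.mem_filter.1 hw).2], Finset.sum_const,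
    ← Nat.cast_smul_eq_nsmul ℚ, smul_smul]
  congr 1
  have hfact : ((Fintype.card α).factorial : ℚ) ≠ 0 := Nat.cast_ne_zero.2 (Nat.factorial_ne_zero _)
  rw [← card_partition_eq_mul_centralizerOrder μ, Nat.cast_mul] at hfact ⊢
  have := left_ne_zero_of_mul hfact
  field_simp

theorem cycleIndex_zero : cycleIndex a 0 = 1 := by
  simp [cycleIndex, centralizerOrder]

theorem sum_mul_count_parts {n : ℕ} (μ : n.Partition) :
    ∑ k ∈ Finset.Icc 1 n, k * μ.parts.count k = n := by
  have hsub : μ.parts.toFinset ⊆ Finset.Icc 1 n := fun k hk => by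
    rw [Multiset.mem_toFinset] at hk
    exact Finset.mem_Icc.2 ⟨μ.parts_pos hk, Nat.Partition.le_of_mem_parts hk⟩
  conv_rhs => rw [← μ.parts_sum, Finset.sum_multiset_count_of_subset _ _ hsub]
  simp only [smul_eq_mul, mul_comm]

/- Removing one part `k` from `μ` divides `z_μ` by `k` times the multiplicity of `k`. -/
theorem sum_count_smul_eq_mul_cycleIndex {n k : ℕ} (hk : 1 ≤ k) (hkn : k ≤ n) :
    ∑ μ : n.Partition, (((k * μ.parts.count k : ℕ) : ℚ) * (centralizerOrder μ.parts : ℚ)⁻¹) •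
      (μ.parts.map a).prod = a k * cycleIndex a (n - k) := by
  rw [← Finset.sum_filter_of_ne (p := fun μ : n.Partition => k ∈ μ.parts) fun μ _ hne => by
      by_contra h
      simp [Multiset.count_eq_zero_of_notMem h] at hne,
    Finset.sum_subtype (p := fun μ : n.Partition => k ∈ μ.parts) _ (by simp),
    cycleIndex, Finset.mul_sum, ← (Nat.Partition.partitionWithPartEquiv hk hkn).sum_comp]
  refine Finset.sum_congr rfl fun μ _ => ?_
  obtain ⟨s, hs⟩ := Multiset.exists_cons_of_mem μ.2
  rw [Nat.Partition.partitionWithPartEquiv_apply_parts, hs, Multiset.erase_cons_head,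
    centralizerOrder_cons, Multiset.map_cons, Multiset.prod_cons, Multiset.count_cons_self,
    mul_smul_comm]
  congr 1
  have hzero : 0 ∉ s := fun h => (μ.1.parts_pos (hs ▸ Multiset.mem_cons_of_mem h)).ne rfl
  have horder : (centralizerOrder s : ℚ) ≠ 0 := Nat.cast_ne_zero.2 (centralizerOrder_ne_zero hzero)
  have hcast : ((k * (s.count k + 1) : ℕ) : ℚ) ≠ 0 := by positivity
  rw [Nat.cast_mul (centralizerOrder s)]
  field_simp

theorem smul_cycleIndex (n : ℕ) :
    (n : ℚ) • cycleIndex a n = ∑ k ∈ Finset.Icc 1 n, a k * cycleIndex a (n - k) := by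
  rw [← Finset.sum_congr rfl fun k hk => sum_count_smul_eq_mul_cycleIndex a
      (Finset.mem_Icc.1 hk).1 (Finset.mem_Icc.1 hk).2, Finset.sum_comm, cycleIndex,
    Finset.smul_sum]
  refine Finset.sum_congr rfl fun μ _ => ?_
  rw [← Finset.sum_smul, ← Finset.sum_mul, ← Nat.cast_sum, sum_mul_count_parts, smul_smul]

section generatingFunction

open PowerSeries

theorem derivative_mk_cycleIndex :
    d⁄dX A (PowerSeries.mk (cycleIndex a)) =
      PowerSeries.mk (fun k => a (k + 1)) * PowerSeries.mk (cycleIndex a) := by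
  ext n
  rw [coeff_derivative, coeff_mul, Finset.Nat.sum_antidiagonal_eq_sum_range_succ_mk]
  simp only [coeff_mk]
  calc cycleIndex a (n + 1) * ((n : A) + 1) = ((n + 1 : ℕ) : ℚ) • cycleIndex a (n + 1) := by
        rw [Algebra.smul_def, map_natCast, Nat.cast_succ, mul_comm]
    _ = ∑ k ∈ Finset.Ico (0 + 1) (n + 1 + 1), a k * cycleIndex a (n + 1 - k) := smul_cycleIndex a _
    _ = ∑ k ∈ Finset.range (n + 1), a (k + 1) * cycleIndex a (n - k) := by
        rw [Finset.range_eq_Ico, ← Finset.sum_Ico_add' _ 0 (n + 1) 1]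
        simp only [Nat.add_sub_add_right]

theorem eq_of_derivative_eq_mul {F G c : A⟦X⟧} (hF : d⁄dX A F = c * F) (hG : d⁄dX A G = c * G)
    (h0 : constantCoeff F = constantCoeff G) : F = G := by
  ext n
  induction n using Nat.strong_induction_on with
  | _ n ih =>
    cases n with
    | zero => simpa using h0
    | succ n =>
      have hcoeff : coeff n (d⁄dX A F) = coeff n (d⁄dX A G) := by
        rw [hF, hG, coeff_mul, coeff_mul]
        refine Finset.sum_congr rfl fun p hp => ?_
        rw [ih p.2 (Nat.lt_succ_of_le (Finset.HasAntidiagonal.antidiagonal.snd_le hp))]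
      have hunit : IsUnit ((n : A) + 1) := by
        have := (IsUnit.mk0 ((n : ℚ) + 1) (by positivity)).map (algebraMap ℚ A)
        simpa using this
      rw [coeff_derivative, coeff_derivative] at hcoeff
      exact hunit.mul_right_cancel hcoeff

theorem derivation_prod {S B ι : Type*} [CommRing S] [CommRing B] [Algebra S B]
    (D : Derivation S B B) (s : Finset ι) {f c : ι → B} (h : ∀ i, D (f i) = c i * f i) :
    D (∏ i ∈ s, f i) = (∑ i ∈ s, c i) * ∏ i ∈ s, f i := by
  classical
  induction s using Finset.induction_on with
  | empty => simp
  | insert i s hi ih =>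
    rw [Finset.prod_insert hi, Finset.sum_insert hi, D.leibniz, ih, h, smul_eq_mul, smul_eq_mul]
    ring

theorem derivative_one_add_X_mul_C {S : Type*} [CommRing S] (z : S) :
    d⁄dX S (1 + X * C z) = PowerSeries.mk (fun k => -(-z) ^ (k + 1)) * (1 + X * C z) := by
  have hD : d⁄dX S (1 + X * C z) = C z := by simp [Derivation.leibniz]
  rw [hD, mul_add, mul_one, ← mul_assoc]
  ext n
  rw [map_add, coeff_mul_C, coeff_mk]
  cases n with
  | zero => simp
  | succ n =>
    rw [coeff_succ_mul_X, coeff_mk, coeff_C, if_neg n.succ_ne_zero]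
    ring

/-- The value of the shiftification `p_k(x/x)` at the variables `z i`, `i ∈ s`. -/
def superPowerSum {S ι : Type*} [CommRing S] (s : Finset ι) (z : ι → S) (k : ℕ) : S :=
  ∑ i ∈ s, (z i ^ k - (-z i) ^ k)

theorem prod_mul_mk_cycleIndex {ι : Type*} (s : Finset ι) (z : ι → A) :
    (∏ i ∈ s, (1 - X * C (z i))) *
        PowerSeries.mk (cycleIndex (superPowerSum s z)) =
      ∏ i ∈ s, (1 + X * C (z i)) := by
  have hplus := derivation_prod (d⁄dX A) s fun i => derivative_one_add_X_mul_C (z i)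
  have hminus := derivation_prod (d⁄dX A) s fun i => derivative_one_add_X_mul_C (-z i)
  simp only [map_neg, mul_neg, ← sub_eq_add_neg, neg_neg] at hminus
  refine eq_of_derivative_eq_mul ?_ hplus ?_
  · rw [Derivation.leibniz, smul_eq_mul, smul_eq_mul, hminus, derivative_mk_cycleIndex]
    have hsplit : PowerSeries.mk (fun k => superPowerSum s z (k + 1)) =
        (∑ i ∈ s, PowerSeries.mk fun k => -(-z i) ^ (k + 1)) -
          ∑ i ∈ s, PowerSeries.mk fun k => -z i ^ (k + 1) := by
      ext k
      simp only [superPowerSum, coeff_mk, map_sub, map_sum, Finset.sum_sub_distrib,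
        Finset.sum_neg_distrib]
      ring
    rw [hsplit]
    ring
  · simp [cycleIndex_zero]

/- Both sides are the part of degree `n` of the Cauchy kernel `∏ (1 + xᵢ yⱼ) / (1 - xᵢ yⱼ)`. -/
theorem sum_shiftedSchur_mul_shiftedSchur (x y : ℕ → A) (N m n : ℕ) :
    ∑ B : Shape n with size B.1 = n, shiftedSchur 1 n x N B * shiftedSchur 2 n y m B =
      cycleIndex
        (fun k => superPowerSum (Finset.range N) x k * ∑ j ∈ Finset.range m, y j ^ k) n := by
  have hprod := prod_mul_mk_cycleIndex (Finset.range m ×ˢ Finset.range N) fun q => x q.2 * y q.1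
  simp only [Finset.prod_product, map_mul, ← mul_assoc] at hprod
  rw [← coeff_cauchy x y N m hprod, coeff_mk]
  congr 1
  funext k
  rw [superPowerSum, superPowerSum, Finset.sum_product_right, Finset.sum_mul_sum]
  refine Finset.sum_congr rfl fun i _ => Finset.sum_congr rfl fun j _ => ?_
  ring

end generatingFunction

end cycleIndex

/-! ### Permutation characters -/

theorem character_ofMulAction {k G X : Type*} [Field k] [Monoid G] [MulAction G X]
    [Finite X] (g : G) :
    (Representation.ofMulAction k G X).character g = Nat.card (MulAction.fixedBy X g) := by
  classical
  have := Fintype.ofFinite X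
  let b : Module.Basis X k (MonoidAlgebra k X) :=
    Module.Basis.ofRepr (MonoidAlgebra.coeffLinearEquiv k)
  have hb (a : X) : b a = MonoidAlgebra.single a 1 := rfl
  rw [Representation.character, LinearMap.trace_eq_matrix_trace k b, Matrix.trace,
    Nat.card_eq_fintype_card, Fintype.card_subtype, Finset.card_filter, Nat.cast_sum]
  refine Finset.sum_congr rfl fun a _ => ?_
  rw [Matrix.diag_apply, LinearMap.toMatrix_apply, hb, Representation.ofMulAction_single]
  change Finsupp.single (g • a) (1 : k) a = _
  rw [Finsupp.single_apply, Nat.cast_ite, Nat.cast_one, Nat.cast_zero]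
  rfl

theorem apply_eq_of_sameCycle {α Y : Type*} {w : Equiv.Perm α} {f : α → Y}
    (h : f ∘ w = f) {x y : α} (hxy : w.SameCycle x y) : f x = f y := by
  obtain ⟨k, rfl⟩ := hxy
  refine zpow_induction_left (P := fun v : Equiv.Perm α => f x = f (v x)) rfl
    (fun v hv => ?_) (fun v hv => ?_) k
  · exact hv.trans (congrFun h (v x)).symm
  · rw [hv, ← congrFun h ((w⁻¹ * v) x), Function.comp_apply, ← Equiv.Perm.mul_apply,
      mul_inv_cancel_left]

section permutations

variable {α : Type*} [Fintype α] [DecidableEq α] (w : Equiv.Perm α)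

theorem card_cycleFactorsFinset_sum_fixedPoints :
    Nat.card (w.cycleFactorsFinset ⊕ Function.fixedPoints w) = w.partition.parts.card := by
  rw [Nat.card_sum, Equiv.Perm.parts_partition, Multiset.card_add, Multiset.card_replicate,
    ← Equiv.Perm.sum_cycleType, ← Equiv.Perm.card_fixedPoints, Equiv.Perm.cycleType_def,
    Multiset.card_map, Finset.card_val, Nat.card_eq_finsetCard, Nat.card_eq_fintype_card]

variable {w} in
/-- The quotient map that sends a nontrivial cycle to the class of its base point. -/
def cycleClass (b : w.Basis) :
    w.cycleFactorsFinset ⊕ Function.fixedPoints w → Quotient (Equiv.Perm.SameCycle.setoid w) :=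
  Sum.elim (fun c => ⟦b c⟧) fun x => ⟦x.1⟧

variable {w} in
theorem bijective_cycleClass (b : w.Basis) : Function.Bijective (cycleClass b) := by
  have hbase (c : w.cycleFactorsFinset) : w (b c) ≠ b c := Equiv.Perm.mem_support.1
    (Equiv.Perm.mem_cycleFactorsFinset_support_le c.2 (b.mem_support_self c))
  constructor
  · rintro (c | x) (c' | y) h
    · have hcycle := (Quotient.exact h : w.SameCycle (b c) (b c')).cycleOf_eq
      rw [b.cycleOf_eq, b.cycleOf_eq] at hcycle
      rw [Subtype.ext hcycle]
    · exact absurd ((Quotient.exact h : w.SameCycle (b c) y).apply_eq_self_iff.2 y.2) (hbase c)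
    · exact absurd ((Quotient.exact h : w.SameCycle x (b c')).apply_eq_self_iff.1 x.2) (hbase c')
    · rw [Subtype.ext ((Quotient.exact h : w.SameCycle x y).eq_of_left x.2)]
  · rintro ⟨x⟩
    rcases b.mem_fixedPoints_or_exists_zpow_eq x with hx | ⟨c, -, k, hk⟩
    · exact ⟨Sum.inr ⟨x, hx⟩, rfl⟩
    · exact ⟨Sum.inl c, Quotient.sound ⟨k, hk⟩⟩

theorem card_quotient_sameCycle :
    Nat.card (Quotient (Equiv.Perm.SameCycle.setoid w)) = w.partition.parts.card := by
  obtain ⟨b⟩ := Equiv.Perm.Basis.nonempty w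
  rw [← card_cycleFactorsFinset_sum_fixedPoints,
    Nat.card_congr (Equiv.ofBijective _ (bijective_cycleClass b))]

theorem card_comp_eq (Y : Type*) :
    Nat.card {f : α → Y // f ∘ w = f} = Nat.card Y ^ w.partition.parts.card := by
  let e : {f : α → Y // f ∘ w = f} ≃ (Quotient (Equiv.Perm.SameCycle.setoid w) → Y) :=
    { toFun f := Quotient.lift f.1 fun _ _ => apply_eq_of_sameCycle f.2
      invFun g := ⟨fun x => g ⟦x⟧, funext fun x => congrArg g (Quotient.sound
        (Equiv.Perm.sameCycle_apply_left.2 (Equiv.Perm.SameCycle.refl w x)))⟩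
      left_inv _ := rfl
      right_inv _ := funext <| Quotient.ind fun _ => rfl }
  rw [Nat.card_congr e, Nat.card_fun, card_quotient_sameCycle]

end permutations

/-! ### Parking functions and rotations -/

theorem forall_le_add_one_iff_of_monotone {n : ℕ} {b : Fin n → ℕ} (hb : Monotone b) :
    (∀ i : Fin n, b i ≤ i + 1) ↔ ∀ j ≤ n, j ≤ (Finset.univ.filter fun i => b i ≤ j).card := by
  constructor
  · intro h j hj
    rw [← Finset.card_fin j]
    refine Finset.card_le_card_of_injOn (Fin.castLE hj) (fun i _ => ?_)
      (Fin.castLE_injective hj).injOn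
    have hi : b (Fin.castLE hj i) ≤ j := (h _).trans (Nat.succ_le_of_lt i.2)
    simpa using hi
  · intro h i
    by_contra! hlt
    have hsub : (Finset.univ.filter fun k => b k ≤ i + 1) ⊆ Finset.Iio i := fun k hk => by
      rw [Finset.mem_Iio]
      by_contra! hik
      exact absurd (hlt.trans_le (hb hik)) (not_lt.2 (Finset.mem_filter.1 hk).2)
    have hcard := (h (i + 1) i.2).trans (Finset.card_le_card hsub)
    rw [Fin.card_Iio] at hcard
    omega

theorem isParking_iff {n : ℕ} (a : Fin n → ℕ) : IsParking a ↔ (∀ i, 1 ≤ a i) ∧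
    ∀ j ≤ n, j ≤ (Finset.univ.filter fun i => a i ≤ j).card := by
  refine and_congr_right fun _ => (forall_le_add_one_iff_of_monotone (Tuple.monotone_sort a)).trans
    (forall₂_congr fun j _ => ?_)
  rw [Finset.card_equiv (Tuple.sort a) (t := Finset.univ.filter fun i => a i ≤ j) (by simp)]

theorem IsParking.le {n : ℕ} {a : Fin n → ℕ} (h : IsParking a) (i : Fin n) : a i ≤ n := by
  have hcard := ((isParking_iff a).1 h).2 n le_rfl
  have hall : (Finset.univ.filter fun i => a i ≤ n) = Finset.univ :=
    Finset.eq_univ_of_card _ ((Finset.card_le_univ _).antisymm (by rwa [Fintype.card_fin]))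
  exact Finset.filter_eq_self.1 hall i (Finset.mem_univ i)

instance (n : ℕ) : Finite (ParkingFunction n) :=
  Finite.of_injective (β := Fin n → Fin (n + 1))
    (fun a i => ⟨a.1 i, Nat.lt_succ_of_le (a.2.le i)⟩)
    fun _ _ h => Subtype.ext (funext fun i => congrArg Fin.val (congrFun h i))

section cycleLemma

variable {S : ℕ → ℤ} {m : ℕ}

theorem exists_forall_le_of_add_period (hm : 0 < m) (hS : ∀ k, S (k + m) = S k - 1) :
    ∃ r < m, ∀ j < m, S r ≤ S (r + j) := by
  classical
  have hex : ∃ r, r < m ∧ ∀ k < m, S r ≤ S k := by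
    simpa using Finset.exists_min_image (Finset.range m) S (Finset.nonempty_range_iff.2 hm.ne')
  obtain ⟨hr, hmin⟩ := Nat.find_spec hex
  have hfirst (i : ℕ) (hi : i < Nat.find hex) : S (Nat.find hex) < S i := by
    have := Nat.find_min hex hi
    push Not at this
    obtain ⟨k, hk, hlt⟩ := this (hi.trans hr)
    exact (hmin k hk).trans_lt hlt
  refine ⟨Nat.find hex, hr, fun j hj => ?_⟩
  rcases lt_or_ge (Nat.find hex + j) m with h | h
  · exact hmin _ h
  · obtain ⟨i, hi⟩ := Nat.exists_eq_add_of_le' h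
    rw [hi, hS]
    exact Int.le_sub_one_of_lt (hfirst i (by omega))

theorem le_of_forall_le_add (hS : ∀ k, S (k + m) = S k - 1) {r s : ℕ} (hr : r < m)
    (hrmin : ∀ j < m, S r ≤ S (r + j)) (hsmin : ∀ j < m, S s ≤ S (s + j)) : r ≤ s := by
  by_contra! hlt
  have hsr : S s ≤ S r := by simpa [hlt.le] using hsmin (r - s) (by omega)
  have hrs := hrmin (s + m - r) (by omega)
  rw [Nat.add_sub_cancel' (by omega), hS] at hrs
  omega

theorem existsUnique_forall_le_of_add_period (hm : 0 < m) (hS : ∀ k, S (k + m) = S k - 1) :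
    ∃! r, r < m ∧ ∀ j < m, S r ≤ S (r + j) := by
  obtain ⟨r, hr, hrmin⟩ := exists_forall_le_of_add_period hm hS
  exact ⟨r, ⟨hr, hrmin⟩, fun s hs => (le_of_forall_le_add hS hs.1 hs.2 hrmin).antisymm
    (le_of_forall_le_add hS hr hrmin hs.2)⟩

end cycleLemma

theorem card_val_sub_lt {ι : Type*} [Fintype ι] {m j : ℕ} [NeZero m] (hj : j ≤ m)
    (f : ι → ZMod m) (r : ℕ) : (Finset.univ.filter fun i => (f i - r).val < j).card =
      ∑ l ∈ Finset.range j, (Finset.univ.filter fun i => f i = ((r + l : ℕ) : ZMod m)).card := by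
  rw [Finset.card_eq_sum_card_fiberwise (f := fun i => (f i - r).val) (t := Finset.range j)
    fun i hi => by simpa using hi]
  refine Finset.sum_congr rfl fun l hl => congrArg Finset.card (Finset.ext fun i => ?_)
  have hlj := Finset.mem_range.1 hl
  simp only [Finset.mem_filter, Finset.mem_univ, true_and, Nat.cast_add]
  constructor
  · rintro ⟨-, h⟩
    rw [← h, ZMod.natCast_zmod_val, add_sub_cancel]
  · intro h
    rw [h, add_sub_cancel_left, ZMod.val_natCast_of_lt (hlj.trans_le hj)]
    exact ⟨hlj, rfl⟩

section rotations

variable {n : ℕ}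

theorem isParking_val_sub_add_one_iff (f : Fin n → ZMod (n + 1)) (c : ZMod (n + 1)) :
    IsParking (fun i => (f i - c).val + 1) ↔
      ∀ j ≤ n, j ≤ (Finset.univ.filter fun i => (f i - c).val < j).card := by
  simp only [isParking_iff, Nat.succ_le_iff, Nat.succ_pos, implies_true, true_and]

/- Adding `#{i | f i = l} - 1` for `l = 0, 1, …` around the circle, one loses `1` in each turn; the
shifts `c` by which `f` becomes a parking function are those from which the sum never drops below
its initial value within one turn, so that the cycle lemma applies. -/
theorem existsUnique_isParking_val_sub_add_one (f : Fin n → ZMod (n + 1)) :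
    ∃! c : ZMod (n + 1), IsParking fun i => (f i - c).val + 1 := by
  let S : ℕ → ℤ := fun k => ∑ l ∈ Finset.range k,
    (((Finset.univ.filter fun i => f i = (l : ZMod (n + 1))).card : ℤ) - 1)
  have hS (r : ℕ) {j : ℕ} (hj : j ≤ n + 1) : S (r + j) = S r +
      ((Finset.univ.filter fun i => (f i - r).val < j).card : ℤ) - j := by
    simp only [S, Finset.sum_range_add, card_val_sub_lt hj, Nat.cast_sum, Finset.sum_sub_distrib,
      Finset.sum_const, Finset.card_range, nsmul_eq_mul, mul_one]
    push_cast
    ring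
  have hperiod (k : ℕ) : S (k + (n + 1)) = S k - 1 := by
    rw [hS k le_rfl, Finset.filter_true_of_mem fun i _ => ZMod.val_lt _, Finset.card_fin]
    push_cast
    ring
  have hiff (r : ℕ) : (∀ j < n + 1, S r ≤ S (r + j)) ↔
      IsParking fun i => (f i - (r : ZMod (n + 1))).val + 1 := by
    rw [isParking_val_sub_add_one_iff]
    refine forall_congr' fun j => imp_congr_ctx Nat.lt_succ_iff fun hj => ?_
    rw [hS r (by omega)]
    omega
  obtain ⟨r, ⟨-, hr⟩, hunique⟩ := existsUnique_forall_le_of_add_period n.succ_pos hperiod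
  refine ⟨r, (hiff r).1 hr, fun c hc => ?_⟩
  rw [← ZMod.natCast_zmod_val c] at hc ⊢
  rw [hunique c.val ⟨ZMod.val_lt c, (hiff _).2 hc⟩]

/-- Pollak's rotation: the parking function `a` on a circle with `n + 1` spots, moved by `c`. -/
def rotate (q : ParkingFunction n × ZMod (n + 1)) (i : Fin n) : ZMod (n + 1) :=
  ((q.1.1 i - 1 : ℕ) : ZMod (n + 1)) + q.2

theorem val_rotate_sub_add_one (q : ParkingFunction n × ZMod (n + 1)) (i : Fin n) :
    (rotate q i - q.2).val + 1 = q.1.1 i := by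
  have hpos := q.1.2.1 i
  have hle := q.1.2.le i
  rw [rotate, add_sub_cancel_right, ZMod.val_natCast_of_lt (by omega), Nat.sub_add_cancel hpos]

theorem bijective_rotate : Function.Bijective (rotate (n := n)) := by
  constructor
  · intro q q' h
    have hparking (q : ParkingFunction n × ZMod (n + 1)) :
        IsParking fun i => (rotate q i - q.2).val + 1 := by
      simpa only [val_rotate_sub_add_one] using q.1.2
    have hshift : q.2 = q'.2 := (existsUnique_isParking_val_sub_add_one (rotate q')).unique
      (h ▸ hparking q) (hparking q')
    refine Prod.ext (Subtype.ext (funext fun i => ?_)) hshift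
    rw [← val_rotate_sub_add_one q, ← val_rotate_sub_add_one q', h, hshift]
  · intro f
    obtain ⟨c, hc, -⟩ := existsUnique_isParking_val_sub_add_one f
    refine ⟨(⟨_, hc⟩, c), funext fun i => ?_⟩
    rw [rotate, Nat.add_sub_cancel, ZMod.natCast_zmod_val, sub_add_cancel]

theorem mem_fixedBy_iff_rotate_comp (w : Equiv.Perm (Fin n))
    (q : ParkingFunction n × ZMod (n + 1)) :
    q.1 ∈ MulAction.fixedBy (ParkingFunction n) w ↔ rotate q ∘ w = rotate q := by
  have hcomp : q.1 ∈ MulAction.fixedBy (ParkingFunction n) w ↔ q.1.1 ∘ w = q.1.1 := by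
    rw [← MulAction.fixedBy_inv, MulAction.mem_fixedBy]
    exact Subtype.ext_iff
  rw [hcomp]
  refine ⟨fun h => funext fun i => ?_, fun h => funext fun i => ?_⟩
  · rw [Function.comp_apply, rotate, rotate, ← congrFun h i, Function.comp_apply]
  · rw [Function.comp_apply, ← val_rotate_sub_add_one, ← val_rotate_sub_add_one, ← congrFun h i,
      Function.comp_apply]

theorem card_fixedBy_parkingFunction_mul (w : Equiv.Perm (Fin n)) :
    Nat.card (MulAction.fixedBy (ParkingFunction n) w) * (n + 1) =
      (n + 1) ^ w.partition.parts.card := by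
  conv_lhs => rw [← Nat.card_zmod (n + 1), ← Nat.card_prod]
  conv_rhs => rw [← Nat.card_zmod (n + 1), ← card_comp_eq]
  exact Nat.card_congr (Equiv.prodSubtypeFstEquivSubtypeProd.symm.trans
    ((Equiv.ofBijective rotate bijective_rotate).subtypeEquiv (mem_fixedBy_iff_rotate_comp w)))

theorem character_parkingFunction (w : Equiv.Perm (Fin n)) :
    (Representation.ofMulAction ℚ (Equiv.Perm (Fin n)) (ParkingFunction n)).character w =
      ((n : ℚ) + 1)⁻¹ * ((n : ℚ) + 1) ^ w.partition.parts.card := by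
  rw [character_ofMulAction, eq_inv_mul_iff_mul_eq₀ (by positivity), mul_comm]
  exact_mod_cast card_fixedBy_parkingFunction_mul w

end rotations

/-! ### Restriction to finitely many variables -/

/-- The substitution `x_i = 0` for all `i ≥ N`. -/
def restrictVars (N : ℕ) : Series →ₐ[ℚ] Series :=
  MvPowerSeries.rescaleAlgHom fun i => if i < N then 1 else 0

open Classical in
theorem coeff_restrictVars (N : ℕ) (f : Series) (d : ℕ →₀ ℕ) :
    MvPowerSeries.coeff d (restrictVars N f) =
      if ∀ i, N ≤ i → d i = 0 then MvPowerSeries.coeff d f else 0 := by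
  rw [restrictVars, MvPowerSeries.rescaleAlgHom_apply, MvPowerSeries.coeff_rescale]
  split_ifs with hd
  · rw [Finsupp.prod, Finset.prod_eq_one, one_mul]
    intro i hi
    rw [if_pos (not_le.1 (mt (hd i) (Finsupp.mem_support_iff.1 hi))), one_pow]
  · push Not at hd
    obtain ⟨i, hi, hne⟩ := hd
    rw [Finsupp.prod, Finset.prod_eq_zero (Finsupp.mem_support_iff.2 hne), zero_mul]
    rw [if_neg (not_lt.2 hi), zero_pow hne]

theorem eq_of_restrictVars_eq {f g : Series} (h : ∀ N, restrictVars N f = restrictVars N g) :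
    f = g := by
  ext d
  obtain ⟨N, hN⟩ := d.support.bddAbove
  have hd (i : ℕ) (hi : N + 1 ≤ i) : d i = 0 :=
    Finsupp.notMem_support_iff.1 fun hmem => absurd (hN hmem) (not_le.2 hi)
  have hcoeff := congrArg (MvPowerSeries.coeff d) (h (N + 1))
  rwa [coeff_restrictVars, coeff_restrictVars, if_pos hd, if_pos hd] at hcoeff

theorem restrictVars_powerSum (N : ℕ) {k : ℕ} (hk : k ≠ 0) :
    restrictVars N (powerSum k) = ∑ i ∈ Finset.range N, (MvPowerSeries.X i : Series) ^ k := by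
  classical
  ext d
  rw [coeff_restrictVars, coeff_powerSum, map_sum]
  simp only [MvPowerSeries.coeff_X_pow]
  by_cases hex : ∃ i, d = Finsupp.single i k
  · obtain ⟨i, rfl⟩ := hex
    have hrange : (∀ j, N ≤ j → Finsupp.single i k j = 0) ↔ i ∈ Finset.range N := by
      rw [Finset.mem_range, ← not_le]
      refine ⟨fun h hi => hk ?_, fun h j hj => Finsupp.single_eq_of_ne fun hji => h (hji ▸ hj)⟩
      rw [← h i hi, Finsupp.single_eq_same]
    simp only [hrange, (Finsupp.single_left_injective hk).eq_iff, exists_eq', if_true,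
      Finset.sum_ite_eq]
  · rw [if_neg hex, ite_self, Finset.sum_eq_zero]
    exact fun i _ => if_neg fun h => hex ⟨i, h⟩

theorem restrictVars_schurP {n : ℕ} {lam : n.Partition} (h : lam ∈ Nat.Partition.distincts n)
    (N : ℕ) : restrictVars N (schurP lam) =
      shiftedSchur 1 n (fun i => (MvPowerSeries.X i : Series)) N (shape lam) := by
  classical
  ext d
  rw [coeff_restrictVars]
  split_ifs with hd
  · exact coeff_schurP h hd
  · rw [← tableauSum_two_mul, tableauSum, map_sum, Finset.sum_eq_zero]
    intro T _
    rw [tableauWeight_X h, MvPowerSeries.coeff_monomial, if_neg]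
    rintro rfl
    exact hd ((MarkedShiftedTableau.abs_lt_iff_weight_eq_zero _).1 (tableauEquiv h N T).2)

/-! ### Both sides of the theorem as cycle indices -/

theorem map_parkingSym {A : Type*} [CommRing A] [Algebra ℚ A] (F : Sym →ₐ[ℚ] A) (n : ℕ) :
    F (parkingSym n) = ((n : ℚ) + 1)⁻¹ • cycleIndex (fun k => F (symP k) * ((n : A) + 1)) n := by
  have hindex := sum_perm_eq_cycleIndex (fun k => F (symP k) * ((n : A) + 1)) (Fin n)
  simp only [Fintype.card_fin] at hindex
  rw [← hindex, parkingSym, frobeniusCh, map_smul, map_sum, smul_comm]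
  congr 1
  rw [Finset.smul_sum]
  refine Finset.sum_congr rfl fun w _ => ?_
  rw [map_smul, character_parkingFunction, mul_smul, symPPart, map_multiset_prod,
    Multiset.map_map, Multiset.prod_map_mul, Multiset.map_const', Multiset.prod_replicate,
    mul_comm _ (_ ^ _), Algebra.smul_def (_ ^ _), map_pow, map_add, map_natCast, map_one]
  rfl

theorem shiftification_symP {k : ℕ} (hk : 1 ≤ k) :
    shiftification (symP k) = symP k + (-1 : ℚ) ^ (k - 1) • symP k := by
  simp [shiftification, superfication, twoAlphabets, omega, symLift_symP _ k hk]

theorem restrictVars_shiftification_symP (N : ℕ) {k : ℕ} (hk : 1 ≤ k) :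
    restrictVars N (shiftification (symP k) : Series) =
      superPowerSum (Finset.range N) MvPowerSeries.X k := by
  rw [shiftification_symP hk, Subalgebra.coe_add, Subalgebra.coe_smul, coe_symP _ hk, map_add,
    map_smul, restrictVars_powerSum _ (Nat.one_le_iff_ne_zero.1 hk), Finset.smul_sum,
    ← Finset.sum_add_distrib, superPowerSum]
  refine Finset.sum_congr rfl fun i _ => ?_
  obtain ⟨k, rfl⟩ := Nat.exists_eq_add_of_le' hk
  rw [neg_pow (MvPowerSeries.X i : Series) (k + 1), Nat.add_sub_cancel, Algebra.smul_def, map_pow,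
    map_neg, map_one]
  ring

theorem restrictVars_shiftedParkingSym (N n : ℕ) :
    restrictVars N (shiftedParkingSym n : Series) = ((n : ℚ) + 1)⁻¹ •
      cycleIndex
        (fun k => superPowerSum (Finset.range N) MvPowerSeries.X k * ((n : Series) + 1)) n := by
  rw [cycleIndex_congr fun k hk => by rw [← restrictVars_shiftification_symP N hk]]
  exact map_parkingSym (((restrictVars N).comp Sym.val).comp shiftification) n

theorem restrictVars_sum_schurP (N n : ℕ) :
    restrictVars N (∑ lam ∈ Nat.Partition.distincts n,
      ((2 : ℚ) ^ lam.parts.card * evalOnes (n + 1) (schurP lam)) • schurP lam) =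
      cycleIndex
        (fun k => superPowerSum (Finset.range N) MvPowerSeries.X k * ((n : Series) + 1)) n := by
  have hcauchy := sum_shiftedSchur_mul_shiftedSchur (fun i => (MvPowerSeries.X i : Series))
    (fun _ => 1) N (n + 1) n
  simp only [one_pow, Finset.sum_const, Finset.card_range, nsmul_one, Nat.cast_succ] at hcauchy
  rw [← sum_distincts n fun B => shiftedSchur 1 n _ N B * shiftedSchur 2 n _ (n + 1) B] at hcauchy
  rw [map_sum]
  refine (Finset.sum_congr rfl fun lam h => ?_).trans hcauchy
  rw [map_smul, restrictVars_schurP h, evalOnes_schurP h, shiftedSchur_eq_pow_card_mul 2,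
    card_shape h, Algebra.smul_def, map_mul, map_shiftedSchur, map_pow, map_ofNat, mul_comm]
  simp only [map_one]

end ShiftedParking

end

theorem theorem2 (n : ℕ) :
    (ShiftedParking.shiftedParkingSym n : MvPowerSeries ℕ ℚ) =
      ((n : ℚ) + 1)⁻¹ • ∑ lam ∈ Nat.Partition.distincts n,
        ((2 : ℚ) ^ lam.parts.card * ShiftedParking.evalOnes (n + 1) (ShiftedParking.schurP lam)) •
          ShiftedParking.schurP lam := by
  refine ShiftedParking.eq_of_restrictVars_eq fun N => ?_
  rw [ShiftedParking.restrictVars_shiftedParkingSym, map_smul,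
    ShiftedParking.restrictVars_sum_schurP]
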